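/- Let $\mathbf k$ be a field of characteristic $0$ and $d\ge 0$. Notation and definitions: * *Jouanolou model.* $\mathbf J^n=\mathbf k[z_i^s,x_{ij}^s,\mathbf d x_{ij}^s]\big/\big(\sum_s x_{ij}^s(z_i^s-z_j^s)-1,\ \sum_s \mathbf d x_{ij}^s(z_i^s-z_j^s)\big)$, where $1\le i\ne j\le n$, $1\le s\le d$, $x_{ij}^s=-x_{ji}^s$; the $z,x$ have degree $0$, the $\mathbf dx$ have degree $1$ (graded commutative). It has the differential $\mathbf d$ with $\mathbf d z=0$, $\mathbf d(x_{ij}^s)=\mathbf dx_{ij}^s$, and it is a left $\mathcal D$-module on $(\mathbb A^d)^n$: $z_i^s$ acts by multiplication and $\partial_{z_j^t}$ by the derivation commuting with $\mathbf d$ with $\partial_{z_j^t}x_{jl}^s=-x_{jl}^tx_{jl}^s$. * *Chiral operations.* For a dg right $\mathcal D_{\mathbb A^d}$-module $\mathcal A$ (identified with its global sections), $\mathcal P(n)$ is the space of $\mathcal D_{(\mathbb A^d)^n}$-linear maps $\mathbf J^n(\mathcal A^{\boxtimes n})\to\Delta_*\mathcal A$, where $\mathbf J^n(M)=M\otimes_{\mathcal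 O}\mathbf J^n$ and $\Delta_*\mathcal A=\mathcal A\otimes_{\mathbf k[\lambda_\star]}\mathbf k[\lambda_1,\dots,\lambda_n]$, with $\lambda^s_\star=\sum_i\lambda^s_i$ acting on $\mathcal A$ as $\partial_{z^s}$, and $(a\otimes F)z_i^s=az^s\otimes F+a\otimes\partial F/\partial\lambda_i^s$, $(a\otimes F)\partial_{z_i^s}=a\otimes\lambda_i^sF$. The group $S_n$ acts by permuting inputs (with Koszul signs) and indices. The composition $\mu''\circ_S\mu'$ of $\mu'\in\mathcal P(S)$ and $\mu''\in\mathcal P(\{\bullet\}\sqcup S^c)$ uses the factorization $\mathbf J^n=\mathbf J^S\otimes\mathbf J^{(S),S^c}$, where $\mathbf J^{(S),S^c}$ is the Jouanolou algebra for the pairs not contained in $S$: apply $\mu'$ to the factor of $S$, extend $\mathcal D$-linearly from $\mathcal A$ to $\Delta^S_*\mathcal A=\mathcal A\otimes_{\mathbf k[\lambda_\bullet]}\mathbf k[\lambda_S]$, restrict $\mathbf J^{(S),S^c}$ to the diagonal by $z_i\mapsto z_\bullet$, $x_{ij}\mapsto x_{\bullet j}$ ($i\in S$), and apply $\mu''$.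 * *Homotopy chiral algebra.* A dg right $\mathcal D_{\mathbb A^d}$-module $\mathcal A$ with a map from the operad $\mathcal Lie_\infty$ to $\mathcal P$, that is, with graded antisymmetric operations $\mu_n\in\mathcal P(n)$, $n\ge2$, of degree $2-n$, which satisfy the $L_\infty$ relations, for $n\ge 2$, $$d\circ\mu_n+(-1)^{n-1}\mu_n\circ d+\sum_{2\le|S|<n}(-1)^{|S||S^c|}\chi(S)\;\mu_{|S^c|+1}\circ_S\mu_{|S|}=0,$$ with $\chi(S)$ the antisymmetric Koszul sign of the unshuffle $(S,S^c)$ of the inputs, and $d$ the differentials of $\Delta_*\mathcal A$ and $\mathbf J^n(\mathcal A^{\boxtimes n})$. * *$L_\infty$ algebra.* A $\mathbb Z$-graded vector space with graded antisymmetric multilinear brackets $[-]_n$, $n\ge1$, of degree $2-n$, with $\sum_{\emptyset\ne S\subseteq\{1,\dots,n\}}(-1)^{|S||S^c|}\chi(S)\,[[x_S]_{|S|},x_{S^c}]_{|S^c|+1}=0$ for all $n$. * *De Rham cohomology.* $h(N)=N\otimes_{\mathcal D}\mathcal O$ for a right $\mathcal D$-module $N$ on an affine space, and $[a]\in h(N)$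 is the class of $a\otimes1$. For $n\ge 1$, $a\mapsto a\otimes 1$ induces an isomorphism $h(\mathcal A)\cong h(\Delta_*\mathcal A)$. **Proposition.** Let $\mathcal A$ be a homotopy chiral algebra in the Jouanolou model, with operations $\mu_n$. For $n\ge2$ the composite $\mathcal A^{\boxtimes n}\to\mathbf J^n(\mathcal A^{\boxtimes n})\xrightarrow{\mu_n}\Delta_*\mathcal A$ induces, on applying $h$ and using $h(\Delta_*\mathcal A)\cong h(\mathcal A)$, a well-defined multilinear bracket $[-]_n$ on $h(\mathcal A)=\mathcal A\otimes_{\mathcal D}\mathcal O$; that is, for $a_1,\dots,a_n,b\in\mathcal A$, $$[[a_1],\dots,[a_n]]_n=[b]\iff \big[\mu_n\big((a_1\boxtimes\cdots\boxtimes a_n)\otimes1\big)\big]=[b\otimes1]\ \text{ in } h(\Delta_*\mathcal A).$$ Let $[-]_1$ be induced by the differential of $\mathcal A$, $[[a]]_1=[da]$. Then these brackets exist, are uniquely determined by these formulas, and make the graded vector space $h(\mathcal A)$ (with the grading induced by that of $\mathcal A$) an $L_\infty$ algebra. -/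

import Mathlib

open scoped TensorProduct

noncomputable section

namespace HigherChiral

universe u v w

set_option linter.unusedSimpArgs false
set_option linter.unusedSectionVars false

/-! ### The Jouanolou algebra -/

/-- Generators `z_i^s`, `x_{ij}^s`, `𝐝x_{ij}^s`. -/
inductive Gen (V : Type) (d : ℕ) : Type
  | z (i : V) (s : Fin d)
  | x (i j : V) (s : Fin d)
  | dx (i j : V) (s : Fin d)

/-- The family on the generators with the three given components. -/
def Gen.fam {V : Type} {d : ℕ} {B : Type w} (z : V → Fin d → B) (x dx : V → V → Fin d → B) :
    Gen V d → B
  | .z i s => z i s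
  | .x i j s => x i j s
  | .dx i j s => dx i j s

/-- The relations of the Jouanolou algebra for the pairs `E`, imposed on a family `f` of elements
of a `k`-algebra indexed by the generators. -/
structure Satisfies {V : Type} {d : ℕ} (E : V → V → Prop) {B : Type w} [Ring B]
    (f : Gen V d → B) : Prop where
  z_comm : ∀ i s g, f (.z i s) * f g = f g * f (.z i s)
  x_comm : ∀ i j s g, f (.x i j s) * f g = f g * f (.x i j s)
  dx_anti : ∀ i j s i' j' s', f (.dx i j s) * f (.dx i' j' s') = -(f (.dx i' j' s') * f (.dx i j s))
  x_off : ∀ i j s, ¬ E i j → f (.x i j s) = 0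
  dx_off : ∀ i j s, ¬ E i j → f (.dx i j s) = 0
  x_skew : ∀ i j s, f (.x i j s) = - f (.x j i s)
  dx_skew : ∀ i j s, f (.dx i j s) = - f (.dx j i s)
  x_norm : ∀ i j, E i j → ∑ s, f (.x i j s) * (f (.z i s) - f (.z j s)) = 1
  dx_norm : ∀ i j, E i j → ∑ s, f (.dx i j s) * (f (.z i s) - f (.z j s)) = 0

/-- The same relations, as a relation on the free algebra. -/
inductive Rel (k : Type u) [Field k] {V : Type} {d : ℕ} (E : V → V → Prop) :
    FreeAlgebra k (Gen V d) → FreeAlgebra k (Gen V d) → Prop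
  | z_comm (i s g) : Rel k E (.ι k (.z i s) * .ι k g) (.ι k g * .ι k (.z i s))
  | x_comm (i j s g) : Rel k E (.ι k (.x i j s) * .ι k g) (.ι k g * .ι k (.x i j s))
  | dx_anti (i j s i' j' s') : Rel k E (.ι k (.dx i j s) * .ι k (.dx i' j' s'))
      (-(.ι k (.dx i' j' s') * .ι k (.dx i j s)))
  | x_off (i j s) : ¬ E i j → Rel k E (.ι k (.x i j s)) 0
  | dx_off (i j s) : ¬ E i j → Rel k E (.ι k (.dx i j s)) 0
  | x_skew (i j s) : Rel k E (.ι k (.x i j s)) (-.ι k (.x j i s))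
  | dx_skew (i j s) : Rel k E (.ι k (.dx i j s)) (-.ι k (.dx j i s))
  | x_norm (i j) : E i j →
      Rel k E (∑ s, .ι k (.x i j s) * (.ι k (.z i s) - .ι k (.z j s))) 1
  | dx_norm (i j) : E i j →
      Rel k E (∑ s, .ι k (.dx i j s) * (.ι k (.z i s) - .ι k (.z j s))) 0

/-- The (partial) Jouanolou algebra
`k[z_i^s, x_{ij}^s, 𝐝x_{ij}^s] / (∑ x_{ij}^s (z_i^s - z_j^s) - 1, ∑ 𝐝x_{ij}^s (z_i^s - z_j^s))`
on the points `V` of `𝔸^d`, with variables `x_{ij} = - x_{ji}` for the pairs with `E i j`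
(the variables of the other pairs are zero); `z`, `x` are even and `𝐝x` is odd. -/
def Jou (k : Type u) [Field k] (d : ℕ) {V : Type} (E : V → V → Prop) : Type u :=
  RingQuot (Rel k (d := d) E)

namespace Jou

variable {k : Type u} [Field k] {d : ℕ} {V : Type} {E : V → V → Prop}

instance : Ring (Jou k d E) := inferInstanceAs (Ring (RingQuot (Rel k (d := d) E)))
instance : Algebra k (Jou k d E) := inferInstanceAs (Algebra k (RingQuot (Rel k (d := d) E)))

/-- The quotient map from the free algebra. -/
def ofFree : FreeAlgebra k (Gen V d) →ₐ[k] Jou k d E := RingQuot.mkAlgHom k (Rel k E)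

/-- The class of a generator. -/
def gen (g : Gen V d) : Jou k d E := ofFree (FreeAlgebra.ι k g)

theorem ofFree_rel {a b : FreeAlgebra k (Gen V d)} (h : Rel k E a b) :
    (ofFree a : Jou k d E) = ofFree b := RingQuot.mkAlgHom_rel k h

theorem gen_sat : Satisfies E (gen : Gen V d → Jou k d E) where
  z_comm i s g := by simpa [gen] using ofFree_rel (Rel.z_comm (k := k) (E := E) i s g)
  x_comm i j s g := by simpa [gen] using ofFree_rel (Rel.x_comm (k := k) (E := E) i j s g)
  dx_anti i j s i' j' s' := by
    simpa [gen] using ofFree_rel (Rel.dx_anti (k := k) (E := E) i j s i' j' s')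
  x_off i j s h := by simpa [gen] using ofFree_rel (Rel.x_off (k := k) i j s h)
  dx_off i j s h := by simpa [gen] using ofFree_rel (Rel.dx_off (k := k) i j s h)
  x_skew i j s := by simpa [gen] using ofFree_rel (Rel.x_skew (k := k) (E := E) i j s)
  dx_skew i j s := by simpa [gen] using ofFree_rel (Rel.dx_skew (k := k) (E := E) i j s)
  x_norm i j h := by simpa [gen] using ofFree_rel (Rel.x_norm (k := k) (d := d) i j h)
  dx_norm i j h := by simpa [gen] using ofFree_rel (Rel.dx_norm (k := k) (d := d) i j h)

/-- The universal property. -/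
def lift {B : Type w} [Ring B] [Algebra k B] (f : Gen V d → B) (hf : Satisfies E f) :
    Jou k d E →ₐ[k] B :=
  RingQuot.liftAlgHom k ⟨FreeAlgebra.lift k f, by
    intro x y h
    induction h with
    | z_comm i s g => simpa using hf.z_comm i s g
    | x_comm i j s g => simpa using hf.x_comm i j s g
    | dx_anti i j s i' j' s' => simpa using hf.dx_anti i j s i' j' s'
    | x_off i j s h => simpa using hf.x_off i j s h
    | dx_off i j s h => simpa using hf.dx_off i j s h
    | x_skew i j s => simpa using hf.x_skew i j s
    | dx_skew i j s => simpa using hf.dx_skew i j s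
    | x_norm i j h => simpa using hf.x_norm i j h
    | dx_norm i j h => simpa using hf.dx_norm i j h⟩

@[simp] theorem lift_gen {B : Type w} [Ring B] [Algebra k B] (f : Gen V d → B)
    (hf : Satisfies E f) (g : Gen V d) : lift (k := k) f hf (gen g) = f g := by
  simp only [lift, gen, ofFree]
  erw [RingQuot.liftAlgHom_mkAlgHom_apply]
  simp

theorem induct {P : Jou k d E → Prop} (hc : ∀ c : k, P (algebraMap k _ c)) (hg : ∀ g, P (gen g))
    (hm : ∀ a b, P a → P b → P (a * b)) (ha : ∀ a b, P a → P b → P (a + b)) (a : Jou k d E) :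
    P a := by
  obtain ⟨a, rfl⟩ : ∃ b, ofFree b = a := RingQuot.mkAlgHom_surjective k (Rel k E) a
  induction a using FreeAlgebra.induction with
  | grade0 c => rw [AlgHom.commutes]; exact hc c
  | grade1 g => exact hg g
  | mul a b h h' => rw [map_mul]; exact hm _ _ h h'
  | add a b h h' => rw [map_add]; exact ha _ _ h h'

/-- The coordinates `z_i^s` are central. -/
theorem z_central (i : V) (s : Fin d) (a : Jou k d E) : gen (.z i s) * a = a * gen (.z i s) := by
  induction a using induct with
  | hc c => exact (Algebra.commutes c _).symm
  | hg g => exact gen_sat.z_comm i s g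
  | hm a b h h' => rw [← mul_assoc, h, mul_assoc, h', mul_assoc]
  | ha a b h h' => rw [mul_add, add_mul, h, h']

theorem x_central (i j : V) (s : Fin d) (a : Jou k d E) :
    gen (.x i j s) * a = a * gen (.x i j s) := by
  induction a using induct with
  | hc c => exact (Algebra.commutes c _).symm
  | hg g => exact gen_sat.x_comm i j s g
  | hm a b h h' => rw [← mul_assoc, h, mul_assoc, h', mul_assoc]
  | ha a b h h' => rw [mul_add, add_mul, h, h']

/-- The parity automorphism `a ↦ (-1)^{|a|} a`. -/
def eps : Jou k d E →ₐ[k] Jou k d E :=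
  lift (Gen.fam (fun i s => gen (.z i s)) (fun i j s => gen (.x i j s))
    (fun i j s => -gen (.dx i j s)))
  { z_comm := fun i s g => z_central i s _
    x_comm := fun i j s g => x_central i j s _
    dx_anti := by intro i j s i' j' s'; simpa [Gen.fam] using gen_sat.dx_anti i j s i' j' s'
    x_off := fun i j s h => gen_sat.x_off i j s h
    dx_off := by intro i j s h; simpa [Gen.fam] using gen_sat.dx_off i j s h
    x_skew := fun i j s => gen_sat.x_skew i j s
    dx_skew := fun i j s => congrArg Neg.neg (gen_sat.dx_skew i j s)
    x_norm := fun i j h => gen_sat.x_norm i j h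
    dx_norm := by
      intro i j h
      simpa [Gen.fam, Finset.sum_neg_distrib] using gen_sat.dx_norm i j h }

end Jou

/-- The upper triangular matrix `(a, b; 0, c)`. -/
def tri {B : Type w} [Ring B] (a b c : B) : Matrix (Fin 2) (Fin 2) B := !![a, b; 0, c]

section tri

variable {B : Type w} [Ring B] (a b c a' b' c' : B)

theorem tri_mul : tri a b c * tri a' b' c' = tri (a * a') (a * b' + b * c') (c * c') := by
  simp [tri]

theorem tri_neg : -tri a b c = tri (-a) (-b) (-c) := by simp [tri]

theorem tri_sub : tri a b c - tri a' b' c' = tri (a - a') (b - b') (c - c') := by simp [tri]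

theorem tri_zero : tri (0 : B) 0 0 = 0 := by
  simp [tri, ← Matrix.ext_iff, Fin.forall_fin_two]

theorem tri_one : tri (1 : B) 0 1 = 1 := by
  simp [tri, ← Matrix.ext_iff, Fin.forall_fin_two]

theorem tri_sum {ι : Type} (s : Finset ι) (f g h : ι → B) :
    ∑ i ∈ s, tri (f i) (g i) (h i) = tri (∑ i ∈ s, f i) (∑ i ∈ s, g i) (∑ i ∈ s, h i) := by
  simp [tri, ← Matrix.ext_iff, Fin.forall_fin_two, Matrix.sum_apply]

end tri

namespace Jou

variable {k : Type u} [Field k] {d : ℕ} {V : Type} {E : V → V → Prop}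

/-- `𝐝 z = 0`, `𝐝 (x) = 𝐝x` and `𝐝 (𝐝x) = 0`. -/
def diffGen : Gen V d → Jou k d E :=
  Gen.fam (fun _ _ => 0) (fun i j s => gen (.dx i j s)) (fun _ _ _ => 0)

/-- The algebra homomorphism `a ↦ (ε a, 𝐝 a; 0, a)`. -/
def diffHom : Jou k d E →ₐ[k] Matrix (Fin 2) (Fin 2) (Jou k d E) :=
  lift (fun g => tri (eps (gen g)) (diffGen g) (gen g))
  { z_comm := by
      rintro i s g
      simp [tri_mul, eps, diffGen, Gen.fam, z_central]
    x_comm := by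
      rintro i j s (⟨i', s'⟩ | ⟨i', j', s'⟩ | ⟨i', j', s'⟩)
      · simp [tri_mul, eps, diffGen, Gen.fam, z_central]
      · simp only [tri_mul, eps, diffGen, Gen.fam, lift_gen, ← x_central i' j' s' (gen (.dx i j s)),
          x_central i j s, add_comm]
      · simp [tri_mul, eps, diffGen, Gen.fam, x_central i j s, gen_sat.dx_anti i j s i' j' s']
    dx_anti := by
      intro i j s i' j' s'
      simp [tri_mul, tri_neg, eps, diffGen, Gen.fam, gen_sat.dx_anti i j s i' j' s']
    x_off := by
      intro i j s h
      simp [tri_zero, eps, diffGen, Gen.fam, gen_sat.x_off i j s h, gen_sat.dx_off i j s h]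
    dx_off := by
      intro i j s h
      simp [tri_zero, eps, diffGen, Gen.fam, gen_sat.dx_off i j s h]
    x_skew := by
      intro i j s
      simp [tri_neg, eps, diffGen, Gen.fam, ← gen_sat.x_skew i j s, ← gen_sat.dx_skew i j s]
    dx_skew := by
      intro i j s
      simp [tri_neg, eps, diffGen, Gen.fam, ← gen_sat.dx_skew i j s, ← gen_sat.dx_skew j i s]
    x_norm := by
      intro i j h
      simp [tri_mul, tri_sub, tri_sum, ← tri_one, eps, diffGen, Gen.fam,
        gen_sat.x_norm i j h, gen_sat.dx_norm i j h]
    dx_norm := by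
      intro i j h
      simp [tri_mul, tri_sub, tri_sum, ← tri_zero, eps, diffGen, Gen.fam,
        gen_sat.dx_norm i j h, Finset.sum_neg_distrib] }

/-- The relative de Rham differential `𝐝`, an odd derivation. -/
def diff : Jou k d E →ₗ[k] Jou k d E where
  toFun a := diffHom a 0 1
  map_add' a b := by simp
  map_smul' r a := by simp

section del

variable [DecidableEq V]

/-- `∂_{z_j} (z_a - z_b)`, as a scalar. -/
def coef (k : Type u) [Field k] (j a b : V) : k :=
  (if a = j then 1 else 0) - (if b = j then 1 else 0)

theorem coef_swap (j a b : V) : coef k j b a = -coef k j a b := by simp [coef]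

/-- For `∂ = ∂_{z_j^t}` and `c = (j, t)`: `∂ z_i^s = δ_{ij} δ_{st}`,
`∂ x_{ab}^s = -(δ_{aj} - δ_{bj}) x_{ab}^t x_{ab}^s` and `∂ 𝐝x_{ab}^s = 𝐝 ∂ x_{ab}^s`. -/
def delGen (c : V × Fin d) : Gen V d → Jou k d E :=
  Gen.fam (fun i s => if (i, s) = c then 1 else 0)
    (fun a b s => -(coef k c.1 a b • (gen (.x a b c.2) * gen (.x a b s))))
    (fun a b s => -(coef k c.1 a b •
      (gen (.dx a b c.2) * gen (.x a b s) + gen (.x a b c.2) * gen (.dx a b s))))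

theorem sum_coef (c : V × Fin d) (i j : V) (y : Fin d → Jou k d E) :
    ∑ s, y s * (delGen c (.z i s) - delGen c (.z j s)) = coef k c.1 i j • y c.2 := by
  obtain ⟨a, t⟩ := c
  have h : ∀ i : V, ∑ s, y s * (delGen (a, t) (.z i s)) = (if i = a then (1 : k) else 0) • y t := by
    intro i
    by_cases hi : i = a <;> simp [delGen, Gen.fam, hi]
  simp only [mul_sub, Finset.sum_sub_distrib, h, coef, sub_smul]

/-- The algebra homomorphism `a ↦ (a, ∂a; 0, a)`. -/
def delHom (c : V × Fin d) : Jou k d E →ₐ[k] Matrix (Fin 2) (Fin 2) (Jou k d E) :=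
  lift (fun g => tri (gen g) (delGen c g) (gen g))
  { z_comm := by
      rintro i s g
      have h : delGen c (.z i s) * gen g = gen g * (delGen c (.z i s) : Jou k d E) := by
        simp only [delGen, Gen.fam]
        split_ifs <;> simp
      rw [tri_mul, tri_mul, h, z_central, z_central, add_comm]
    x_comm := by
      rintro i j s g
      have h : delGen c (.x i j s) * gen g = gen g * (delGen c (.x i j s) : Jou k d E) := by
        simp only [delGen, Gen.fam, neg_mul, mul_neg, smul_mul_assoc, mul_smul_comm]
        rw [mul_assoc, x_central, x_central, mul_assoc, x_central]
      rw [tri_mul, tri_mul, h, x_central, x_central, add_comm]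
    dx_anti := by
      intro i j s i' j' s'
      have h : ∀ i j s i' j' s', gen (.dx i j s) * delGen c (.dx i' j' s') =
          -((delGen c (.dx i' j' s') : Jou k d E) * gen (.dx i j s)) := by
        intro i j s i' j' s'
        have h1 : gen (.dx i j s) * (gen (.dx i' j' c.2) * gen (.x i' j' s')) =
            -((gen (.dx i' j' c.2) * gen (.x i' j' s') : Jou k d E) * gen (.dx i j s)) := by
          rw [← mul_assoc, gen_sat.dx_anti, mul_assoc, x_central, neg_mul, mul_assoc]
        have h2 : gen (.dx i j s) * (gen (.x i' j' c.2) * gen (.dx i' j' s')) =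
            -((gen (.x i' j' c.2) * gen (.dx i' j' s') : Jou k d E) * gen (.dx i j s)) := by
          rw [x_central, ← mul_assoc, gen_sat.dx_anti, neg_mul, mul_assoc, mul_assoc,
            x_central i' j' c.2 (gen (.dx i j s))]
        simp only [delGen, Gen.fam, neg_mul, mul_neg, smul_mul_assoc, mul_smul_comm, mul_add,
          add_mul, h1, h2, smul_add, smul_neg]
        abel
      rw [tri_mul, tri_mul, tri_neg, h, gen_sat.dx_anti i j s, neg_add, h i' j' s', neg_neg,
        add_comm]
    x_off := by
      intro i j s h
      simp [delGen, Gen.fam, gen_sat.x_off i j _ h, tri_zero]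
    dx_off := by
      intro i j s h
      simp [delGen, Gen.fam, gen_sat.dx_off i j _ h, tri_zero]
    x_skew := by
      intro i j s
      simp [delGen, Gen.fam, gen_sat.x_skew j i, coef_swap _ i j, tri_neg]
    dx_skew := by
      intro i j s
      simp [delGen, Gen.fam, gen_sat.x_skew j i, gen_sat.dx_skew j i, coef_swap _ i j, tri_neg,
        add_comm]
    x_norm := by
      intro i j h
      have h1 := (gen_sat (k := k) (d := d)).x_norm i j h
      simp only [tri_mul, tri_sub, tri_sum, ← tri_one, h1, Finset.sum_add_distrib, sum_coef c i j]
      simp only [delGen, Gen.fam, neg_mul, smul_mul_assoc, mul_assoc, Finset.sum_neg_distrib,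
        ← Finset.smul_sum, ← Finset.mul_sum, h1, mul_one, add_neg_cancel]
    dx_norm := by
      intro i j h
      have h1 := (gen_sat (k := k) (d := d)).x_norm i j h
      have h2 := (gen_sat (k := k) (d := d)).dx_norm i j h
      simp only [tri_mul, tri_sub, tri_sum, ← tri_zero, h2, Finset.sum_add_distrib, sum_coef c i j]
      simp only [delGen, Gen.fam, neg_mul, smul_mul_assoc, mul_assoc, add_mul,
        Finset.sum_neg_distrib, Finset.sum_add_distrib,
        ← Finset.smul_sum, ← Finset.mul_sum, h1, h2, mul_one, mul_zero, add_zero,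
        add_neg_cancel] }

/-- The derivation `∂_{z_j^t}`, for `c = (j, t)`. -/
def del (c : V × Fin d) : Jou k d E →ₗ[k] Jou k d E where
  toFun a := delHom c a 0 1
  map_add' a b := by simp
  map_smul' r a := by simp

theorem del_apply (c : V × Fin d) (a : Jou k d E) : del c a = delHom c a 0 1 := rfl

theorem delHom_apply (c : V × Fin d) (a : Jou k d E) : delHom c a = tri a (del c a) a := by
  simp only [del_apply]
  induction a using induct with
  | hc r =>
    simp [tri, ← Matrix.ext_iff, Fin.forall_fin_two, Matrix.algebraMap_matrix_apply]
  | hg g => simp [delHom, tri]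
  | hm a b h h' =>
    have e : delHom c (a * b) = delHom c a * delHom c b := map_mul _ _ _
    rw [e, h, h', tri_mul]
    simp [tri]
  | ha a b h h' =>
    have e : delHom c (a + b) = delHom c a + delHom c b := map_add _ _ _
    rw [e, h, h']
    simp [tri]

@[simp] theorem del_gen (c : V × Fin d) (g : Gen V d) :
    del c (gen g : Jou k d E) = delGen c g := by
  simp [delHom, del_apply, tri]

@[simp] theorem del_one (c : V × Fin d) : del c (1 : Jou k d E) = 0 := by
  simp [del_apply]

@[simp] theorem del_algebraMap (c : V × Fin d) (r : k) :
    del c (algebraMap k (Jou k d E) r) = 0 := by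
  simp [del_apply, Matrix.algebraMap_matrix_apply]

theorem del_mul (c : V × Fin d) (a b : Jou k d E) :
    del c (a * b) = a * del c b + del c a * b := by
  have h : delHom c (a * b) = delHom c a * delHom c b := map_mul _ _ _
  rw [delHom_apply, delHom_apply, delHom_apply, tri_mul] at h
  simpa [tri] using congrFun (congrFun h 0) 1

theorem del_z_mul (c : V × Fin d) (i : V) (s : Fin d) (a : Jou k d E) :
    del c (gen (.z i s) * a) = gen (.z i s) * del c a + if (i, s) = c then a else 0 := by
  rw [del_mul, del_gen, delGen, Gen.fam]
  split_ifs <;> simp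

/-- The vector fields `∂_{z_j^t}` commute. -/
theorem del_comm (c c' : V × Fin d) (a : Jou k d E) : del c (del c' a) = del c' (del c a) := by
  induction a using induct with
  | hc r => simp
  | hg g =>
    rcases g with ⟨i, s⟩ | ⟨i, j, s⟩ | ⟨i, j, s⟩
    · simp only [del_gen, delGen, Gen.fam]
      split_ifs <;> simp
    · have e := x_central (k := k) (E := E) i j c.2 (gen (.x i j c'.2))
      simp only [del_gen, delGen, Gen.fam, map_neg, map_smul, del_mul, mul_neg, neg_mul,
        mul_smul_comm, smul_mul_assoc, ← mul_assoc, e, smul_add, smul_neg, smul_smul,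
        mul_comm (coef k c.1 i j)]
    · have e := x_central (k := k) (E := E) i j c.2 (gen (.x i j c'.2))
      have e1 := x_central (k := k) (E := E) i j c.2 (gen (.dx i j c'.2))
      have e2 := x_central (k := k) (E := E) i j c'.2 (gen (.dx i j c.2))
      simp only [del_gen, delGen, Gen.fam, map_neg, map_smul, map_add, del_mul, mul_neg, neg_mul,
        mul_smul_comm, smul_mul_assoc, ← mul_assoc, e, e1, e2, smul_add, smul_neg, smul_smul,
        mul_comm (coef k c.1 i j), mul_add, add_mul]
      abel
  | hm a b h h' =>
    simp only [del_mul, map_add, h, h']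
    abel
  | ha a b h h' => simp only [map_add, h, h']

end del

section map

variable {W : Type} {E' : W → W → Prop}

/-- Functoriality in the set of points: `z_i ↦ z_{r(i)}`, `x_{ij} ↦ x_{r(i) r(j)}`. -/
def map (r : V → W) (hr : ∀ i j, E i j ↔ E' (r i) (r j)) : Jou k d E →ₐ[k] Jou k d E' :=
  lift (Gen.fam (fun i s => gen (.z (r i) s)) (fun i j s => gen (.x (r i) (r j) s))
    (fun i j s => gen (.dx (r i) (r j) s)))
  { z_comm := fun i s g => z_central (r i) s _
    x_comm := fun i j s g => x_central (r i) (r j) s _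
    dx_anti := fun i j s i' j' s' => gen_sat.dx_anti _ _ s _ _ s'
    x_off := fun i j s h => gen_sat.x_off _ _ s (by rwa [← hr])
    dx_off := fun i j s h => gen_sat.dx_off _ _ s (by rwa [← hr])
    x_skew := fun i j s => gen_sat.x_skew _ _ s
    dx_skew := fun i j s => gen_sat.dx_skew _ _ s
    x_norm := fun i j h => gen_sat.x_norm _ _ (by rwa [← hr])
    dx_norm := fun i j h => gen_sat.dx_norm _ _ (by rwa [← hr]) }

/-- Along `r`, the vector field `∂_{z_w}` is the image of the sum of the `∂_{z_i}` with
`r(i) = w`. -/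
theorem map_sum_del [DecidableEq V] [Fintype V] [DecidableEq W] (r : V → W)
    (hr : ∀ i j, E i j ↔ E' (r i) (r j)) (w : W) (t : Fin d) (a : Jou k d E) :
    map r hr (∑ i with r i = w, del (i, t) a) = del (w, t) (map r hr a) := by
  induction a using induct with
  | hc c => simp
  | hg g =>
    have hc : ∀ a b : V, ∑ i with r i = w, coef k i a b = coef k w (r a) (r b) := by
      intro a b
      simp [coef, Finset.sum_sub_distrib]
    rcases g with ⟨i, s⟩ | ⟨i, j, s⟩ | ⟨i, j, s⟩
    · have hz : ∀ x : V, map r hr (if (i, s) = (x, t) then 1 else 0 : Jou k d E) =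
          if i = x then (if s = t then 1 else 0) else 0 := by
        intro x
        by_cases h1 : i = x <;> by_cases h2 : s = t <;> simp [h1, h2]
      simp only [map_sum, del_gen, delGen, Gen.fam, hz, Finset.sum_ite_eq]
      by_cases h1 : r i = w <;> by_cases h2 : s = t <;>
        simp [map, Gen.fam, delGen, h1, h2]
    · simp only [del_gen, delGen, Gen.fam, map_neg, map_smul, Finset.sum_neg_distrib,
        ← Finset.sum_smul, hc]
      simp [map, Gen.fam, delGen]
    · simp only [del_gen, delGen, Gen.fam, map_neg, map_smul, Finset.sum_neg_distrib,
        ← Finset.sum_smul, hc]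
      simp [map, Gen.fam, delGen]
  | hm a b h h' =>
    simp only [del_mul, map_mul, ← h, ← h', map_add, map_sum, Finset.sum_add_distrib,
      Finset.mul_sum, Finset.sum_mul]
  | ha a b h h' => simp only [map_add, Finset.sum_add_distrib, h, h']

end map

end Jou

/-! ### Right `𝒟`-modules -/

section DModule

/-- A right module over the Weyl algebra `k⟨z_c, ∂_c : c ∈ C⟩`, `[∂_c, z_{c'}] = δ_{cc'}`, the
algebra of differential operators on the affine space with coordinates `z_c`, `c ∈ C`. -/
class RightDModule (k : Type u) [Field k] (C : Type) (N : Type v) [AddCommGroup N] [Module k N] where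
  /-- `n ↦ n · z_c` -/
  zOp : C → N →ₗ[k] N
  /-- `n ↦ n · ∂_c` -/
  delOp : C → N →ₗ[k] N
  zOp_comm : ∀ a b n, zOp a (zOp b n) = zOp b (zOp a n)
  delOp_comm : ∀ a b n, delOp a (delOp b n) = delOp b (delOp a n)
  weylOp_same : ∀ a n, zOp a (delOp a n) - delOp a (zOp a n) = n
  weylOp_ne : ∀ a b, a ≠ b → ∀ n, zOp a (delOp b n) = delOp b (zOp a n)

variable (k : Type u) [Field k] {C : Type} {N : Type v} [AddCommGroup N] [Module k N]
  [RightDModule k C N] {N' : Type w} [AddCommGroup N'] [Module k N'] [RightDModule k C N']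

/-- The right action `n ↦ n · z_c`. -/
def zAct (c : C) : N →ₗ[k] N := RightDModule.zOp c

/-- The right action `n ↦ n · ∂_c`. -/
def delAct (c : C) : N →ₗ[k] N := RightDModule.delOp c

theorem zAct_comm (a b : C) (n : N) : zAct k a (zAct k b n) = zAct k b (zAct k a n) :=
  RightDModule.zOp_comm a b n

theorem delAct_comm (a b : C) (n : N) : delAct k a (delAct k b n) = delAct k b (delAct k a n) :=
  RightDModule.delOp_comm a b n

theorem weyl_same (a : C) (n : N) : zAct k a (delAct k a n) = n + delAct k a (zAct k a n) :=
  sub_eq_iff_eq_add.1 (RightDModule.weylOp_same a n)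

theorem weyl_ne {a b : C} (h : a ≠ b) (n : N) :
    zAct k a (delAct k b n) = delAct k b (zAct k a n) :=
  RightDModule.weylOp_ne a b h n

variable {k} in
/-- `f` is a morphism of right `𝒟`-modules. -/
structure IsDLinear (C : Type) [RightDModule k C N] [RightDModule k C N'] (f : N →ₗ[k] N') :
    Prop where
  z : ∀ (c : C) n, f (zAct k c n) = zAct k c (f n)
  del : ∀ (c : C) n, f (delAct k c n) = delAct k c (f n)

end DModule

open scoped IsMulCommutative in
/-- The action of polynomials through a commuting family of operators. -/
def polyAct {k : Type u} [Field k] {C : Type} {N : Type v} [AddCommGroup N] [Module k N]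
    (f : C → Module.End k N) (hf : ∀ a b, f a * f b = f b * f a) :
    MvPolynomial C k →ₐ[k] Module.End k N :=
  haveI := Algebra.isMulCommutative_adjoin k (s := Set.range f)
    (by rintro _ ⟨a, rfl⟩ _ ⟨b, rfl⟩; exact hf a b)
  (Subalgebra.val (Algebra.adjoin k (Set.range f))).comp
    (MvPolynomial.aeval fun c => ⟨f c, Algebra.subset_adjoin ⟨c, rfl⟩⟩)

@[simp] theorem polyAct_X {k : Type u} [Field k] {C : Type} {N : Type v} [AddCommGroup N]
    [Module k N] (f : C → Module.End k N) (hf : ∀ a b, f a * f b = f b * f a) (c : C) :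
    polyAct f hf (MvPolynomial.X c) = f c := by
  simp [polyAct]

/-! ### External products, Jouanolou models and diagonal push-forwards -/

section ExtProd

variable {k : Type u} [Field k] {A : Type v} [AddCommGroup A] [Module k A] {n : ℕ} {D : Type}

/-- The operator `f` in the `i`-th tensor factor. -/
def slot (i : Fin n) (f : A →ₗ[k] A) : (⨂[k] _ : Fin n, A) →ₗ[k] (⨂[k] _ : Fin n, A) :=
  PiTensorProduct.map (Function.update (fun _ => LinearMap.id) i f)

@[simp] theorem slot_tprod (i : Fin n) (f : A →ₗ[k] A) (m : Fin n → A) :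
    slot i f (PiTensorProduct.tprod k m) =
      PiTensorProduct.tprod k (Function.update m i (f (m i))) := by
  rw [slot, PiTensorProduct.map_tprod]
  congr 1
  ext j
  by_cases h : j = i
  · subst h; simp
  · simp [h]

theorem slot_comm {i j : Fin n} (h : i ≠ j) (f g : A →ₗ[k] A) (x : ⨂[k] _ : Fin n, A) :
    slot i f (slot j g x) = slot j g (slot i f x) := by
  induction x using PiTensorProduct.induction_on with
  | smul_tprod r m => simp [h, h.symm, Function.update_comm h]
  | add x y hx hy => simp only [map_add, hx, hy]

theorem slot_slot (i : Fin n) (f g : A →ₗ[k] A) (x : ⨂[k] _ : Fin n, A) :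
    slot i f (slot i g x) = slot i (f ∘ₗ g) x := by
  induction x using PiTensorProduct.induction_on with
  | smul_tprod r m => simp
  | add x y hx hy => simp only [map_add, hx, hy]

theorem slot_sub (i : Fin n) (f g : A →ₗ[k] A) (x : ⨂[k] _ : Fin n, A) :
    slot i (f - g) x = slot i f x - slot i g x := by
  induction x using PiTensorProduct.induction_on with
  | smul_tprod r m => simp [smul_sub, MultilinearMap.map_update_sub]
  | add x y hx hy => simp only [map_add, hx, hy]; abel

theorem slot_id (i : Fin n) (x : ⨂[k] _ : Fin n, A) : slot i LinearMap.id x = x := by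
  induction x using PiTensorProduct.induction_on with
  | smul_tprod r m => simp
  | add x y hx hy => simp only [map_add, hx, hy]

/-- The external product `A ⊠ ⋯ ⊠ A`, a right `𝒟`-module on the `n`-fold product. -/
instance extProd [RightDModule k D A] : RightDModule k (Fin n × D) (⨂[k] _ : Fin n, A) where
  zOp c := slot c.1 (zAct k c.2)
  delOp c := slot c.1 (delAct k c.2)
  zOp_comm a b x := by
    by_cases h : a.1 = b.1
    · simp only [h, slot_slot]
      congr 2; ext y; exact zAct_comm k _ _ _
    · exact slot_comm h _ _ _
  delOp_comm a b x := by
    by_cases h : a.1 = b.1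
    · simp only [h, slot_slot]
      congr 2; ext y; exact delAct_comm k _ _ _
    · exact slot_comm h _ _ _
  weylOp_same a x := by
    rw [slot_slot, slot_slot, ← slot_sub]
    convert slot_id a.1 x using 2
    congr 1; ext y; exact sub_eq_iff_eq_add.2 (weyl_same k _ y)
  weylOp_ne a b hab x := by
    by_cases h : a.1 = b.1
    · simp only [h, slot_slot]
      congr 2; ext y
      exact weyl_ne k (fun h' => hab (Prod.ext h h')) _
    · exact slot_comm h _ _ _

end ExtProd

section JModel

variable (k : Type u) [Field k] (d : ℕ) {V : Type} (E : V → V → Prop)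
  (N : Type v) [AddCommGroup N] [Module k N] [RightDModule k (V × Fin d) N]

/-- The relations `n z_c ⊗ a = n ⊗ z_c a`. -/
def jmRel : Submodule k (N ⊗[k] Jou k d E) :=
  Submodule.span k {y | ∃ (n : N) (c : V × Fin d) (a : Jou k d E),
    y = zAct k c n ⊗ₜ a - n ⊗ₜ (Jou.gen (.z c.1 c.2) * a)}

/-- The Jouanolou model `N ⊗_𝒪 𝐉` of a right `𝒟`-module `N`. -/
def JModel : Type (max u v) := (N ⊗[k] Jou k d E) ⧸ jmRel k d E N

instance : AddCommGroup (JModel k d E N) :=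
  inferInstanceAs (AddCommGroup ((N ⊗[k] Jou k d E) ⧸ jmRel k d E N))
instance : Module k (JModel k d E N) :=
  inferInstanceAs (Module k ((N ⊗[k] Jou k d E) ⧸ jmRel k d E N))

namespace JModel

variable {k d E N}

/-- The class of `n ⊗ a`. -/
def mk : N →ₗ[k] Jou k d E →ₗ[k] JModel k d E N :=
  (TensorProduct.mk k N (Jou k d E)).compr₂ (jmRel k d E N).mkQ

theorem z_mk (c : V × Fin d) (n : N) (a : Jou k d E) :
    mk (zAct k c n) a = mk n (Jou.gen (.z c.1 c.2) * a) :=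
  (Submodule.Quotient.eq _).2 (Submodule.subset_span ⟨n, c, a, rfl⟩)

theorem induct {P : JModel k d E N → Prop} (h0 : P 0) (hm : ∀ n a, P (mk n a))
    (ha : ∀ x y, P x → P y → P (x + y)) (x : JModel k d E N) : P x := by
  obtain ⟨x, rfl⟩ := (jmRel k d E N).mkQ_surjective x
  induction x using TensorProduct.induction_on with
  | zero => rw [map_zero]; exact h0
  | tmul n a => exact hm n a
  | add x y hx hy => rw [map_add]; exact ha _ _ hx hy

/-- The linear map induced by a bilinear map. -/
def lift {M : Type w} [AddCommGroup M] [Module k M] (f : N →ₗ[k] Jou k d E →ₗ[k] M)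
    (hf : ∀ (c : V × Fin d) n a, f (zAct k c n) a = f n (Jou.gen (.z c.1 c.2) * a)) : JModel k d E N →ₗ[k] M :=
  (jmRel k d E N).liftQ (TensorProduct.lift f) (by
    rw [jmRel, Submodule.span_le]
    rintro _ ⟨n, c, a, rfl⟩
    simp [hf])

@[simp] theorem lift_mk {M : Type w} [AddCommGroup M] [Module k M] (f : N →ₗ[k] Jou k d E →ₗ[k] M)
    (hf : ∀ (c : V × Fin d) n a, f (zAct k c n) a = f n (Jou.gen (.z c.1 c.2) * a)) (n : N) (a : Jou k d E) :
    lift f hf (mk n a) = f n a := by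
  simp only [lift, mk]
  erw [Submodule.liftQ_apply]

variable [DecidableEq V]

/-- `(n ⊗ a) z_c = n z_c ⊗ a` -/
def actZ (c : V × Fin d) : JModel k d E N →ₗ[k] JModel k d E N :=
  lift (mk ∘ₗ zAct k c) (by
    intro c' n a
    simp only [LinearMap.comp_apply]
    rw [zAct_comm, z_mk])

/-- `(n ⊗ a) ∂_c = n ∂_c ⊗ a - n ⊗ ∂_c a` -/
def actDel (c : V × Fin d) : JModel k d E N →ₗ[k] JModel k d E N :=
  lift (mk ∘ₗ delAct k c - mk.compl₂ (Jou.del c)) (by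
    intro c' n a
    simp only [LinearMap.comp_apply, LinearMap.sub_apply, LinearMap.compl₂_apply, Jou.del_z_mul]
    by_cases h : c' = c
    · subst h
      have := weyl_same k c' n
      simp only [if_true, map_add]
      rw [← z_mk, ← z_mk, this, map_add, LinearMap.add_apply]
      abel
    · have h' : ¬ ((c'.1, c'.2) = c) := h
      simp only [h', if_false, add_zero]
      rw [← z_mk, ← z_mk, weyl_ne k h])

theorem actZ_mk (c : V × Fin d) (n : N) (a : Jou k d E) :
    actZ c (mk n a) = mk (zAct k c n) a := lift_mk _ _ _ _

theorem actDel_mk (c : V × Fin d) (n : N) (a : Jou k d E) :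
    actDel c (mk n a) = mk (delAct k c n) a - mk n (Jou.del c a) := lift_mk _ _ _ _

instance : RightDModule k (V × Fin d) (JModel k d E N) where
  zOp := actZ
  delOp := actDel
  zOp_comm a b x := by
    induction x using induct with
    | h0 => simp
    | hm n y => simp only [actZ_mk, actDel_mk]; rw [zAct_comm]
    | ha x y hx hy => simp only [map_add, hx, hy]
  delOp_comm a b x := by
    induction x using induct with
    | h0 => simp
    | hm n y =>
      simp only [actZ_mk, actDel_mk,
        map_sub]
      rw [delAct_comm, Jou.del_comm]
      abel
    | ha x y hx hy => simp only [map_add, hx, hy]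
  weylOp_same a x := by
    induction x using induct with
    | h0 => simp
    | hm n y =>
      have := weyl_same k a n
      simp only [actZ_mk, actDel_mk,
        map_sub, this, map_add, LinearMap.add_apply]
      abel
    | ha x y hx hy =>
      simp only [map_add]
      rw [add_sub_add_comm, hx, hy]
  weylOp_ne a b h x := by
    induction x using induct with
    | h0 => simp
    | hm n y =>
      simp only [actZ_mk, actDel_mk,
        map_sub]
      rw [weyl_ne k h]
    | ha x y hx hy => simp only [map_add, hx, hy]

@[simp] theorem zAct_mk (c : V × Fin d) (n : N) (a : Jou k d E) :
    zAct k c (mk n a) = mk (zAct k c n) a := actZ_mk c n a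

@[simp] theorem delAct_mk (c : V × Fin d) (n : N) (a : Jou k d E) :
    delAct k c (mk n a) = mk (delAct k c n) a - mk n (Jou.del c a) := actDel_mk c n a

end JModel

end JModel

section Delta

variable (k : Type u) [Field k] (d n : ℕ) (A : Type v) [AddCommGroup A] [Module k A]
  [RightDModule k (Fin d) A]

/-- The relations `a ∂_s ⊗ F = a ⊗ (∑_i λ_i^s) F`. -/
def deltaRel : Submodule k (A ⊗[k] MvPolynomial (Fin n × Fin d) k) :=
  Submodule.span k {y | ∃ (a : A) (s : Fin d) (F : MvPolynomial (Fin n × Fin d) k),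
    y = delAct k s a ⊗ₜ F - a ⊗ₜ ((∑ i, MvPolynomial.X (i, s)) * F)}

/-- The push-forward `Δ_* A = A ⊗_{k[λ_⋆]} k[λ_1, …, λ_n]` along the diagonal
`𝔸^d → (𝔸^d)^n`, where `λ_⋆ = ∑ λ_i` acts on `A` by `∂`. -/
def Delta : Type (max u v) := (A ⊗[k] MvPolynomial (Fin n × Fin d) k) ⧸ deltaRel k d n A

instance : AddCommGroup (Delta k d n A) :=
  inferInstanceAs (AddCommGroup ((A ⊗[k] MvPolynomial (Fin n × Fin d) k) ⧸ deltaRel k d n A))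
instance : Module k (Delta k d n A) :=
  inferInstanceAs (Module k ((A ⊗[k] MvPolynomial (Fin n × Fin d) k) ⧸ deltaRel k d n A))

namespace Delta

variable {k d n A}

/-- The class of `a ⊗ F`. -/
def mk : A →ₗ[k] MvPolynomial (Fin n × Fin d) k →ₗ[k] Delta k d n A :=
  (TensorProduct.mk k A (MvPolynomial (Fin n × Fin d) k)).compr₂ (deltaRel k d n A).mkQ

theorem del_mk (s : Fin d) (a : A) (F : MvPolynomial (Fin n × Fin d) k) :
    mk (delAct k s a) F = mk a ((∑ i, MvPolynomial.X (i, s)) * F) :=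
  (Submodule.Quotient.eq _).2 (Submodule.subset_span ⟨a, s, F, rfl⟩)

theorem induct {P : Delta k d n A → Prop} (h0 : P 0) (hm : ∀ a F, P (mk a F))
    (ha : ∀ x y, P x → P y → P (x + y)) (x : Delta k d n A) : P x := by
  obtain ⟨x, rfl⟩ := (deltaRel k d n A).mkQ_surjective x
  induction x using TensorProduct.induction_on with
  | zero => rw [map_zero]; exact h0
  | tmul n a => exact hm n a
  | add x y hx hy => rw [map_add]; exact ha _ _ hx hy

/-- The linear map induced by a bilinear map. -/
def lift {M : Type w} [AddCommGroup M] [Module k M]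
    (f : A →ₗ[k] MvPolynomial (Fin n × Fin d) k →ₗ[k] M)
    (hf : ∀ s a F, f (delAct k s a) F = f a ((∑ i, MvPolynomial.X (i, s)) * F)) :
    Delta k d n A →ₗ[k] M :=
  (deltaRel k d n A).liftQ (TensorProduct.lift f) (by
    rw [deltaRel, Submodule.span_le]
    rintro _ ⟨a, s, F, rfl⟩
    simp [hf])

@[simp] theorem lift_mk {M : Type w} [AddCommGroup M] [Module k M]
    (f : A →ₗ[k] MvPolynomial (Fin n × Fin d) k →ₗ[k] M)
    (hf : ∀ s a F, f (delAct k s a) F = f a ((∑ i, MvPolynomial.X (i, s)) * F)) (a : A)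
    (F : MvPolynomial (Fin n × Fin d) k) : lift f hf (mk a F) = f a F := by
  simp only [lift, mk]
  erw [Submodule.liftQ_apply]

theorem pderiv_lam_mul (c : Fin n × Fin d) (s : Fin d) (F : MvPolynomial (Fin n × Fin d) k) :
    MvPolynomial.pderiv c ((∑ i, MvPolynomial.X (i, s)) * F) =
      (∑ i, MvPolynomial.X (i, s)) * MvPolynomial.pderiv c F + if c.2 = s then F else 0 := by
  obtain ⟨j, t⟩ := c
  have : MvPolynomial.pderiv (j, t) (∑ i, MvPolynomial.X (i, s) : MvPolynomial (Fin n × Fin d) k) =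
      if t = s then 1 else 0 := by
    classical
    by_cases h : t = s
    · subst h
      simp [MvPolynomial.pderiv_X, Pi.single_apply]
    · simp [MvPolynomial.pderiv_X, Pi.single_apply, h]
  rw [Derivation.leibniz, this]
  split_ifs <;> simp

theorem pderiv_comm {C : Type} (a b : C) (F : MvPolynomial C k) :
    MvPolynomial.pderiv a (MvPolynomial.pderiv b F) =
      MvPolynomial.pderiv b (MvPolynomial.pderiv a F) := by
  classical
  induction F using MvPolynomial.induction_on with
  | C r => simp
  | add p q hp hq => simp only [map_add, hp, hq]
  | mul_X p c hp =>
    simp only [Derivation.leibniz, map_add, smul_eq_mul, hp, MvPolynomial.pderiv_X, Pi.single_apply]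
    split_ifs <;> simp <;> ring

/-- `(a ⊗ F) z_i^s = a z^s ⊗ F + a ⊗ ∂F/∂λ_i^s` -/
def actZ (c : Fin n × Fin d) : Delta k d n A →ₗ[k] Delta k d n A :=
  lift (mk ∘ₗ zAct k c.2 + mk.compl₂ (MvPolynomial.pderiv c).toLinearMap) (by
    intro s a F
    simp only [LinearMap.comp_apply, LinearMap.add_apply, LinearMap.compl₂_apply,
      Derivation.coeFn_coe, del_mk, pderiv_lam_mul]
    by_cases h : c.2 = s
    · subst h
      have := weyl_same k c.2 a
      simp only [if_true, map_add]
      rw [this, map_add, LinearMap.add_apply, del_mk]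
      abel
    · simp only [h, if_false, add_zero]
      rw [weyl_ne k h, del_mk])

/-- `(a ⊗ F) ∂_{z_i^s} = a ⊗ λ_i^s F` -/
def actDel (c : Fin n × Fin d) : Delta k d n A →ₗ[k] Delta k d n A :=
  lift (mk.compl₂ (LinearMap.mulLeft k (MvPolynomial.X c))) (by
    intro s a F
    simp only [LinearMap.compl₂_apply, del_mk, LinearMap.mulLeft_apply]
    rw [mul_left_comm])

theorem actZ_mk (c : Fin n × Fin d) (a : A) (F : MvPolynomial (Fin n × Fin d) k) :
    actZ c (mk a F : Delta k d n A) = mk (zAct k c.2 a) F + mk a (MvPolynomial.pderiv c F) :=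
  lift_mk _ _ _ _

theorem actDel_mk (c : Fin n × Fin d) (a : A) (F : MvPolynomial (Fin n × Fin d) k) :
    actDel c (mk a F : Delta k d n A) = mk a (MvPolynomial.X c * F) :=
  lift_mk _ _ _ _

instance : RightDModule k (Fin n × Fin d) (Delta k d n A) where
  zOp := actZ
  delOp := actDel
  zOp_comm a b x := by
    induction x using induct with
    | h0 => simp
    | hm y F =>
      simp only [actZ_mk, map_add]
      rw [zAct_comm, pderiv_comm]
      abel
    | ha x y hx hy => simp only [map_add, hx, hy]
  delOp_comm a b x := by
    induction x using induct with
    | h0 => simp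
    | hm y F => simp [actDel_mk, mul_left_comm]
    | ha x y hx hy => simp only [map_add, hx, hy]
  weylOp_same a x := by
    induction x using induct with
    | h0 => simp
    | hm y F => simp [actZ_mk, actDel_mk, weyl_same]
    | ha x y hx hy =>
      simp only [map_add]
      rw [add_sub_add_comm, hx, hy]
  weylOp_ne a b h x := by
    induction x using induct with
    | h0 => simp
    | hm y F => simp [actZ_mk, actDel_mk, MvPolynomial.pderiv_X_of_ne h.symm]
    | ha x y hx hy => simp only [map_add, hx, hy]

@[simp] theorem zAct_mk (c : Fin n × Fin d) (a : A) (F : MvPolynomial (Fin n × Fin d) k) :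
    zAct k c (mk a F : Delta k d n A) = mk (zAct k c.2 a) F + mk a (MvPolynomial.pderiv c F) :=
  actZ_mk c a F

@[simp] theorem delAct_mk (c : Fin n × Fin d) (a : A) (F : MvPolynomial (Fin n × Fin d) k) :
    delAct k c (mk a F : Delta k d n A) = mk a (MvPolynomial.X c * F) :=
  actDel_mk c a F

/-- The push along a map of index sets: `λ_w ↦ ∑_{r(i) = w} λ_i`. -/
def push {m : ℕ} (r : Fin n → Fin m) : Delta k d m A →ₗ[k] Delta k d n A :=
  lift (mk.compl₂ (MvPolynomial.aeval (R := k) (fun c : Fin m × Fin d =>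
      ∑ i with r i = c.1, (MvPolynomial.X (i, c.2) : MvPolynomial (Fin n × Fin d) k))).toLinearMap)
    (by
      intro s a F
      simp only [LinearMap.compl₂_apply, AlgHom.toLinearMap_apply, map_mul, map_sum,
        MvPolynomial.aeval_X, del_mk]
      rw [Finset.sum_fiberwise])

theorem push_delAct {m : ℕ} (r : Fin n → Fin m) (w : Fin m) (s : Fin d) (x : Delta k d m A) :
    push r (delAct k (w, s) x) = ∑ i with r i = w, delAct k (i, s) (push r x) := by
  induction x using induct with
  | h0 => simp
  | hm a F => simp [push, Finset.sum_mul]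
  | ha x y hx hy => simp only [map_add, hx, hy, Finset.sum_add_distrib]

end Delta

end Delta

/-! ### Partial composition of chiral operations -/

section Comp

variable (k : Type u) [Field k] (d : ℕ) {n : ℕ} (S : Finset (Fin n))

/-- The Jouanolou model `𝐉^n` of the configuration space of `n` points in `𝔸^d`. -/
abbrev JConf (n : ℕ) : Type u := Jou k d (fun i j : Fin n => i ≠ j)

/-- The pairs of distinct points which do not both lie in `S`. -/
def outer (i j : Fin n) : Prop := i ≠ j ∧ ¬ (i ∈ S ∧ j ∈ S)

/-- The partial Jouanolou model `𝐉^{(S), Sᶜ}`. -/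
abbrev JOuter : Type u := Jou k d (outer S)

/-- The increasing enumeration of `S`. -/
def enum : Fin S.card ↪o Fin n := S.orderEmbOfFin rfl

/-- The position of an element of `S` in the increasing enumeration. -/
def pos {S : Finset (Fin n)} {i : Fin n} (h : i ∈ S) : Fin S.card := (S.orderIsoOfFin rfl).symm ⟨i, h⟩

variable {S} in
@[simp] theorem enum_pos {i : Fin n} (h : i ∈ S) : enum S (pos h) = i := by
  simp [enum, pos, Finset.orderEmbOfFin]

theorem pos_inj {i j : Fin n} (h : i ∈ S) (h' : j ∈ S) (e : pos h = pos h') : i = j := by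
  rw [← enum_pos h, ← enum_pos h', e]

theorem enum_mem (i : Fin S.card) : enum S i ∈ S := S.orderEmbOfFin_mem rfl i

/-- The surjection `{1, …, n} → {∙} ⊔ Sᶜ` which collapses `S` to the point `∙ = 0`. -/
def collapse (i : Fin n) : Fin (Sᶜ.card + 1) :=
  if h : i ∈ Sᶜ then (pos h).succ else 0

theorem collapse_enum (i : Fin S.card) : collapse S (enum S i) = 0 := by
  simp [collapse, enum_mem]

theorem outer_iff (i j : Fin n) : outer S i j ↔ collapse S i ≠ collapse S j := by
  unfold outer collapse
  by_cases hi : i ∈ S <;> by_cases hj : j ∈ S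
  · simp [hi, hj]
  · simp [hi, hj, ne_of_mem_of_not_mem hi hj, (Fin.succ_ne_zero _).symm]
  · simp [hi, hj, (ne_of_mem_of_not_mem hj hi).symm]
  · have hi' : i ∈ Sᶜ := by simpa using hi
    have hj' : j ∈ Sᶜ := by simpa using hj
    simp only [hi, hj, hi', hj', dif_pos, and_false, not_false_eq_true, and_true, ne_eq,
      Fin.succ_inj]
    exact ⟨fun h e => h (pos_inj _ _ _ e), fun h e => h (by subst e; rfl)⟩

/-- The relations `z_i u ⊗ v = u ⊗ z_i v`, for `i ∈ S`. -/
def splitRel : Submodule k (JConf k d S.card ⊗[k] JOuter k d S) :=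
  Submodule.span k {y | ∃ (u : JConf k d S.card) (i : Fin S.card) (s : Fin d) (v : JOuter k d S),
    y = (Jou.gen (.z i s) * u) ⊗ₜ v - u ⊗ₜ (Jou.gen (.z (enum S i) s) * v)}

/-- The tensor product `𝐉^S ⊗ 𝐉^{(S), Sᶜ}` over the functions on the points of `S`. -/
def JSplit : Type u := (JConf k d S.card ⊗[k] JOuter k d S) ⧸ splitRel k d S

instance : AddCommGroup (JSplit k d S) :=
  inferInstanceAs (AddCommGroup ((JConf k d S.card ⊗[k] JOuter k d S) ⧸ splitRel k d S))
instance : Module k (JSplit k d S) :=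
  inferInstanceAs (Module k ((JConf k d S.card ⊗[k] JOuter k d S) ⧸ splitRel k d S))

namespace JSplit

variable {k d S}

/-- The class of `u ⊗ v`. -/
def mk : JConf k d S.card →ₗ[k] JOuter k d S →ₗ[k] JSplit k d S :=
  (TensorProduct.mk k _ _).compr₂ (splitRel k d S).mkQ

theorem z_mk (i : Fin S.card) (s : Fin d) (u : JConf k d S.card) (v : JOuter k d S) :
    mk (Jou.gen (.z i s) * u) v = mk u (Jou.gen (.z (enum S i) s) * v) :=
  (Submodule.Quotient.eq _).2 (Submodule.subset_span ⟨u, i, s, v, rfl⟩)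

theorem z_mk' {i : Fin n} (h : i ∈ S) (s : Fin d) (u : JConf k d S.card) (v : JOuter k d S) :
    mk u (Jou.gen (.z i s) * v) = mk (Jou.gen (.z (pos h) s) * u) v := by
  rw [z_mk, enum_pos]

theorem induct {P : JSplit k d S → Prop} (h0 : P 0) (hm : ∀ u v, P (mk u v))
    (ha : ∀ x y, P x → P y → P (x + y)) (x : JSplit k d S) : P x := by
  obtain ⟨x, rfl⟩ := (splitRel k d S).mkQ_surjective x
  induction x using TensorProduct.induction_on with
  | zero => rw [map_zero]; exact h0
  | tmul n a => exact hm n a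
  | add x y hx hy => rw [map_add]; exact ha _ _ hx hy

theorem ext {M : Type w} [AddCommGroup M] [Module k M] {f g : JSplit k d S →ₗ[k] M}
    (h : ∀ u v, f (mk u v) = g (mk u v)) : f = g := by
  ext x
  induction x using induct with
  | h0 => simp
  | hm u v => exact h u v
  | ha x y hx hy => rw [map_add, map_add, hx, hy]

/-- The linear map induced by a bilinear map. -/
def lift {M : Type w} [AddCommGroup M] [Module k M]
    (f : JConf k d S.card →ₗ[k] JOuter k d S →ₗ[k] M)
    (hf : ∀ i s u v, f (Jou.gen (.z i s) * u) v = f u (Jou.gen (.z (enum S i) s) * v)) :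
    JSplit k d S →ₗ[k] M :=
  (splitRel k d S).liftQ (TensorProduct.lift f) (by
    rw [splitRel, Submodule.span_le]
    rintro _ ⟨u, i, s, v, rfl⟩
    simp [hf])

@[simp] theorem lift_mk {M : Type w} [AddCommGroup M] [Module k M]
    (f : JConf k d S.card →ₗ[k] JOuter k d S →ₗ[k] M)
    (hf : ∀ i s u v, f (Jou.gen (.z i s) * u) v = f u (Jou.gen (.z (enum S i) s) * v))
    (u : JConf k d S.card) (v : JOuter k d S) : lift f hf (mk u v) = f u v := by
  simp only [lift, mk]
  erw [Submodule.liftQ_apply]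

/-- Left multiplication by `a ⊗ 1`. -/
def opL (a : JConf k d S.card) : Module.End k (JSplit k d S) :=
  lift (mk ∘ₗ LinearMap.mulLeft k a) (by
    intro i s u v
    simp only [LinearMap.comp_apply, LinearMap.mulLeft_apply]
    rw [← z_mk, ← mul_assoc, ← Jou.z_central, mul_assoc])

/-- Left multiplication by `1 ⊗ b`, for `b` even. -/
def opR (b : JOuter k d S) : Module.End k (JSplit k d S) :=
  lift (mk.compl₂ (LinearMap.mulLeft k b)) (by
    intro i s u v
    simp only [LinearMap.compl₂_apply, LinearMap.mulLeft_apply]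
    rw [z_mk, ← mul_assoc, ← mul_assoc, Jou.z_central])

theorem eps_z {V : Type} {E : V → V → Prop} (i : V) (s : Fin d) (a : Jou k d E) :
    Jou.eps (Jou.gen (.z i s) * a) = Jou.gen (.z i s) * Jou.eps a := by
  simp [Jou.eps, Gen.fam]

/-- Left multiplication by `1 ⊗ b`, for `b` odd: `u ⊗ v ↦ (-1)^{|u|} u ⊗ b v`. -/
def opO (b : JOuter k d S) : Module.End k (JSplit k d S) :=
  lift (mk.compl₁₂ Jou.eps.toLinearMap (LinearMap.mulLeft k b)) (by
    intro i s u v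
    simp only [LinearMap.compl₁₂_apply, LinearMap.mulLeft_apply, AlgHom.toLinearMap_apply]
    rw [eps_z, z_mk, ← mul_assoc, ← mul_assoc, Jou.z_central])

@[simp] theorem opL_mk (a u : JConf k d S.card) (v : JOuter k d S) :
    opL a (mk u v) = mk (a * u) v := lift_mk _ _ _ _
@[simp] theorem opR_mk (b : JOuter k d S) (u : JConf k d S.card) (v : JOuter k d S) :
    opR b (mk u v) = mk u (b * v) := lift_mk _ _ _ _
@[simp] theorem opO_mk (b : JOuter k d S) (u : JConf k d S.card) (v : JOuter k d S) :
    opO b (mk u v) = mk (Jou.eps u) (b * v) := lift_mk _ _ _ _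

/-- `x_{ij}^s`, if `i` and `j` both lie in `S`, and zero otherwise. -/
def innerX (i j : Fin n) (s : Fin d) : JConf k d S.card :=
  if h : i ∈ S ∧ j ∈ S then Jou.gen (.x (pos h.1) (pos h.2) s) else 0

/-- `𝐝x_{ij}^s`, if `i` and `j` both lie in `S`, and zero otherwise. -/
def innerDx (i j : Fin n) (s : Fin d) : JConf k d S.card :=
  if h : i ∈ S ∧ j ∈ S then Jou.gen (.dx (pos h.1) (pos h.2) s) else 0

theorem innerX_central (i j : Fin n) (s : Fin d) (a : JConf k d S.card) :
    innerX i j s * a = a * innerX i j s := by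
  unfold innerX
  split_ifs
  · exact Jou.x_central _ _ _ _
  · simp

theorem eps_innerX (i j : Fin n) (s : Fin d) :
    Jou.eps (innerX i j s : JConf k d S.card) = innerX i j s := by
  unfold innerX
  split_ifs
  · simp [Jou.eps, Gen.fam]
  · simp

theorem eps_innerDx (i j : Fin n) (s : Fin d) :
    Jou.eps (innerDx i j s : JConf k d S.card) = -innerDx i j s := by
  unfold innerDx
  split_ifs
  · simp [Jou.eps, Gen.fam]
  · simp

theorem innerDx_anti (i j : Fin n) (s : Fin d) (i' j' : Fin n) (s' : Fin d) :
    (innerDx i j s * innerDx i' j' s' : JConf k d S.card) =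
      -(innerDx i' j' s' * innerDx i j s) := by
  unfold innerDx
  split_ifs
  · exact Jou.gen_sat.dx_anti _ _ _ _ _ _
  all_goals simp

/-- The left action of `𝐉^n` on `𝐉^S ⊗ 𝐉^{(S), Sᶜ}`. -/
def rho : JConf k d n →ₐ[k] Module.End k (JSplit k d S) :=
  Jou.lift (Gen.fam (fun i s => opR (Jou.gen (.z i s)))
    (fun i j s => opL (innerX i j s) + opR (Jou.gen (.x i j s)))
    (fun i j s => opL (innerDx i j s) + opO (Jou.gen (.dx i j s))))
  { z_comm := by
      have hz : ∀ i s (a v : JOuter k d S), Jou.gen (.z i s) * (a * v) =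
          a * (Jou.gen (.z i s) * v) := fun i s a v => by
        rw [← mul_assoc, Jou.z_central, mul_assoc]
      rintro i s (⟨i', s'⟩ | ⟨i', j', s'⟩ | ⟨i', j', s'⟩) <;> refine ext fun u v => ?_ <;>
        simp only [Gen.fam, Module.End.mul_apply, LinearMap.add_apply, opL_mk, opR_mk, opO_mk,
          map_add, hz i s]
    x_comm := by
      have hx : ∀ i j s (a v : JOuter k d S), Jou.gen (.x i j s) * (a * v) =
          a * (Jou.gen (.x i j s) * v) := fun i j s a v => by
        rw [← mul_assoc, Jou.x_central, mul_assoc]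
      have hi : ∀ i j s (a u : JConf k d S.card), innerX i j s * (a * u) =
          a * (innerX i j s * u) := fun i j s a v => by
        rw [← mul_assoc, innerX_central, mul_assoc]
      rintro i j s (⟨i', s'⟩ | ⟨i', j', s'⟩ | ⟨i', j', s'⟩) <;> refine ext fun u v => ?_ <;>
        simp only [Gen.fam, Module.End.mul_apply, LinearMap.add_apply, opL_mk, opR_mk, opO_mk,
          map_add, hx i j s, hi i j s, map_mul, eps_innerX] <;> abel
    dx_anti := by
      intro i j s i' j' s'
      refine ext fun u v => ?_
      have h1 : innerDx i j s * (innerDx i' j' s' * u) = -(innerDx i' j' s' * (innerDx i j s * u)) := by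
        rw [← mul_assoc, innerDx_anti, neg_mul, mul_assoc]
      have h2 : Jou.gen (.dx i j s) * (Jou.gen (.dx i' j' s') * v) =
          -(Jou.gen (.dx i' j' s') * (Jou.gen (.dx i j s) * v)) := by
        rw [← mul_assoc, Jou.gen_sat.dx_anti, neg_mul, mul_assoc]
      simp only [Gen.fam, Module.End.mul_apply, LinearMap.add_apply, LinearMap.neg_apply, opL_mk,
        opO_mk, map_add, h1, h2, map_mul, map_neg, eps_innerDx, neg_mul]
      abel
    x_off := by
      intro i j s h
      obtain rfl : i = j := not_not.1 h
      refine ext fun u v => ?_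
      have h1 : (innerX i i s : JConf k d S.card) = 0 := by
        unfold innerX
        split_ifs
        · exact Jou.gen_sat.x_off _ _ _ (by simp)
        · rfl
      simp [Gen.fam, h1, Jou.gen_sat.x_off i i s (show ¬ outer S i i by simp [outer])]
    dx_off := by
      intro i j s h
      obtain rfl : i = j := not_not.1 h
      refine ext fun u v => ?_
      have h1 : (innerDx i i s : JConf k d S.card) = 0 := by
        unfold innerDx
        split_ifs
        · exact Jou.gen_sat.dx_off _ _ _ (by simp)
        · rfl
      simp [Gen.fam, h1, Jou.gen_sat.dx_off i i s (show ¬ outer S i i by simp [outer])]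
    x_skew := by
      intro i j s
      refine ext fun u v => ?_
      have h1 : (innerX i j s : JConf k d S.card) = -innerX j i s := by
        unfold innerX
        by_cases h : i ∈ S ∧ j ∈ S
        · simpa [h] using Jou.gen_sat.x_skew _ _ _
        · rw [dif_neg h, dif_neg fun h' => h h'.symm, neg_zero]
      simp [Gen.fam, h1, Jou.gen_sat.x_skew i j s, add_comm]
    dx_skew := by
      intro i j s
      refine ext fun u v => ?_
      have h1 : (innerDx i j s : JConf k d S.card) = -innerDx j i s := by
        unfold innerDx
        by_cases h : i ∈ S ∧ j ∈ S
        · simpa [h] using Jou.gen_sat.dx_skew _ _ _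
        · rw [dif_neg h, dif_neg fun h' => h h'.symm, neg_zero]
      simp [Gen.fam, h1, Jou.gen_sat.dx_skew i j s, add_comm]
    x_norm := by
      intro i j hij
      refine ext fun u v => ?_
      by_cases h : i ∈ S ∧ j ∈ S
      · have h0 : ∀ s, (Jou.gen (.x i j s) : JOuter k d S) = 0 := fun s =>
          Jou.gen_sat.x_off _ _ _ (by simp [outer, h])
        have h1 := (Jou.gen_sat (k := k) (d := d)
          (E := fun i j : Fin S.card => i ≠ j)).x_norm (pos h.1) (pos h.2)
          (fun e => hij (pos_inj _ _ _ e))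
        have h2 := congrArg (fun a => mk (a * u) v) h1
        simp only [Finset.sum_mul, map_sum, LinearMap.sum_apply, one_mul] at h2
        simp only [LinearMap.sum_apply, Gen.fam, Module.End.mul_apply, LinearMap.add_apply,
          LinearMap.sub_apply, map_sub, opL_mk, opR_mk, h0, zero_mul, map_zero, add_zero,
          Module.End.one_apply, z_mk' h.1, z_mk' h.2, innerX, h, dif_pos, and_self]
        rw [← h2]
        refine Finset.sum_congr rfl fun s _ => ?_
        rw [mul_assoc, sub_mul, mul_sub, map_sub, LinearMap.sub_apply]
      · have h1 := (Jou.gen_sat (k := k) (d := d) (E := outer S)).x_norm i j ⟨hij, h⟩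
        have h2 := congrArg (fun a => mk u (a * v)) h1
        simp only [Finset.sum_mul, map_sum, LinearMap.sum_apply, one_mul] at h2
        simp only [LinearMap.sum_apply, Gen.fam, Module.End.mul_apply, LinearMap.add_apply,
          LinearMap.sub_apply, map_sub, opL_mk, opR_mk, zero_mul, map_zero, zero_add,
          Module.End.one_apply, innerX, h, dif_neg, not_false_eq_true, LinearMap.zero_apply]
        rw [← h2]
        refine Finset.sum_congr rfl fun s _ => ?_
        rw [mul_assoc, sub_mul, mul_sub, map_sub]
    dx_norm := by
      intro i j hij
      refine ext fun u v => ?_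
      by_cases h : i ∈ S ∧ j ∈ S
      · have h0 : ∀ s, (Jou.gen (.dx i j s) : JOuter k d S) = 0 := fun s =>
          Jou.gen_sat.dx_off _ _ _ (by simp [outer, h])
        have h1 := (Jou.gen_sat (k := k) (d := d)
          (E := fun i j : Fin S.card => i ≠ j)).dx_norm (pos h.1) (pos h.2)
          (fun e => hij (pos_inj _ _ _ e))
        have h2 := congrArg (fun a => mk (a * u) v) h1
        simp only [Finset.sum_mul, map_sum, LinearMap.sum_apply, zero_mul, map_zero,
          LinearMap.zero_apply] at h2
        simp only [LinearMap.sum_apply, Gen.fam, Module.End.mul_apply, LinearMap.add_apply,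
          LinearMap.sub_apply, map_sub, opL_mk, opR_mk, opO_mk, h0, zero_mul, map_zero, add_zero,
          LinearMap.zero_apply, z_mk' h.1, z_mk' h.2, innerDx, h, dif_pos, and_self, eps_z]
        rw [← h2]
        refine Finset.sum_congr rfl fun s _ => ?_
        rw [mul_assoc, sub_mul, mul_sub, map_sub, LinearMap.sub_apply]
      · have h1 := (Jou.gen_sat (k := k) (d := d) (E := outer S)).dx_norm i j ⟨hij, h⟩
        have h2 := congrArg (fun a => mk (Jou.eps u) (a * v)) h1
        simp only [Finset.sum_mul, map_sum, LinearMap.sum_apply, zero_mul, map_zero] at h2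
        simp only [LinearMap.sum_apply, Gen.fam, Module.End.mul_apply, LinearMap.add_apply,
          LinearMap.sub_apply, map_sub, opL_mk, opR_mk, opO_mk, zero_mul, map_zero, zero_add,
          innerDx, h, dif_neg, not_false_eq_true, LinearMap.zero_apply]
        rw [← h2]
        refine Finset.sum_congr rfl fun s _ => ?_
        rw [mul_assoc, sub_mul, mul_sub, map_sub] }

end JSplit

/-- The factorization `𝐉^n = 𝐉^S ⊗ 𝐉^{(S), Sᶜ}`: a product `u v` of an element `u` of `𝐉^S` and an
element `v` of `𝐉^{(S), Sᶜ}` is sent to `u ⊗ v`. -/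
def split : JConf k d n →ₗ[k] JSplit k d S :=
  LinearMap.applyₗ (JSplit.mk 1 1) ∘ₗ JSplit.rho.toLinearMap

/-- The restriction to the diagonal `𝐉^{(S), Sᶜ} → 𝐉^{{∙} ⊔ Sᶜ}`, with `z_i ↦ z_∙` and
`x_{ij} ↦ x_{∙j}` for `i ∈ S`. -/
def restr : JOuter k d S →ₐ[k] JConf k d (Sᶜ.card + 1) :=
  Jou.map (collapse S) (outer_iff S)

end Comp

theorem sum_collapse {n : ℕ} (S : Finset (Fin n)) {M : Type w} [AddCommMonoid M] (φ : Fin n → M) :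
    ∑ i with collapse S i = 0, φ i = ∑ i : Fin S.card, φ (enum S i) := by
  have h : (Finset.univ.filter fun i => collapse S i = 0) = S := by
    ext i
    by_cases hi : i ∈ S <;> simp [collapse, hi]
  rw [h, ← Finset.sum_coe_sort S φ, ← (S.orderIsoOfFin rfl).toEquiv.sum_comp]
  rfl

section Operad

variable {k : Type u} [Field k] {d n : ℕ} {A : Type v} [AddCommGroup A] [Module k A]
  [RightDModule k (Fin d) A]

/-- The element `a ⊗ (m_1 ⊠ ⋯ ⊠ m_n)` of `𝐉^n(A^{⊠ n})`. -/
def JModel.ofTuple (m : Fin n → A) :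
    JConf k d n →ₗ[k] JModel k d (fun i j : Fin n => i ≠ j) (⨂[k] _ : Fin n, A) :=
  JModel.mk (PiTensorProduct.tprod k m)

variable (k d n A) in
/-- The chiral operations `Hom_𝒟(𝐉^n(A^{⊠ n}), Δ_* A)` of arity `n`. -/
def ChiralOp : Type (max u v) :=
  {f : JModel k d (fun i j : Fin n => i ≠ j) (⨂[k] _ : Fin n, A) →ₗ[k] Delta k d n A //
    IsDLinear (Fin n × Fin d) f}

namespace ChiralOp

/-- The value of a chiral operation on `a ⊗ (m_1 ⊠ ⋯ ⊠ m_n)`. -/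
def app (f : ChiralOp k d n A) (m : Fin n → A) : JConf k d n →ₗ[k] Delta k d n A :=
  f.1 ∘ₗ JModel.ofTuple m

theorem app_z (f : ChiralOp k d n A) (m : Fin n → A) (i : Fin n) (s : Fin d) (a : JConf k d n) :
    f.app m (Jou.gen (.z i s) * a) = zAct k (i, s) (f.app m a) := by
  simp only [app, LinearMap.comp_apply, JModel.ofTuple]
  rw [← JModel.z_mk (i, s), ← JModel.zAct_mk, f.2.z]

theorem app_update_z (f : ChiralOp k d n A) (m : Fin n → A) (i : Fin n) (s : Fin d)
    (a : JConf k d n) :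
    f.app (Function.update m i (zAct k s (m i))) a = f.app m (Jou.gen (.z i s) * a) := by
  simp only [app, LinearMap.comp_apply, JModel.ofTuple]
  rw [← slot_tprod, ← JModel.z_mk (i, s)]
  rfl

theorem app_update_del (f : ChiralOp k d n A) (m : Fin n → A) (i : Fin n) (s : Fin d)
    (a : JConf k d n) :
    f.app (Function.update m i (delAct k s (m i))) a =
      delAct k (i, s) (f.app m a) + f.app m (Jou.del (i, s) a) := by
  simp only [app, LinearMap.comp_apply, JModel.ofTuple]
  rw [← f.2.del, JModel.delAct_mk, map_sub, sub_add_cancel, ← slot_tprod]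
  rfl

variable (S : Finset (Fin n)) (f : ChiralOp k d (Sᶜ.card + 1) A) (g : ChiralOp k d S.card A)
  (m : Fin Sᶜ.card → A)

/-- The map `(a, v) ↦ f(a ⊠ m ⊗ v|_diagonal)`, with values in `Δ_* A` on the `n`-fold product. -/
def outerApp : A →ₗ[k] JOuter k d S →ₗ[k] Delta k d n A :=
  LinearMap.mk₂ k (fun a v => Delta.push (collapse S) (f.app (Fin.cons a m) (restr k d S v)))
    (by
      intro a b v
      have := (PiTensorProduct.tprod k).cons_add (M := fun _ => A) m a b
      simp [app, JModel.ofTuple, this])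
    (by
      intro r a v
      have := (PiTensorProduct.tprod k).cons_smul (M := fun _ => A) m r a
      simp [app, JModel.ofTuple, this])
    (by intro a v w; simp)
    (by intro r a v; simp)

theorem outerApp_apply (a : A) (v : JOuter k d S) : outerApp S f m a v =
    Delta.push (collapse S) (f.app (Fin.cons a m) (restr k d S v)) := rfl

/-- The operator by which `λ_i^s`, `i ∈ S`, acts: `h ↦ (v ↦ h(v) ∂_{z_i^s} + h(∂_{z_i^s} v))`. -/
def lamOp (c : Fin S.card × Fin d) : Module.End k (JOuter k d S →ₗ[k] Delta k d n A) :=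
  LinearMap.llcomp k _ _ _ (delAct k (enum S c.1, c.2)) +
    LinearMap.lcomp k _ (Jou.del (enum S c.1, c.2))

theorem lamOp_apply (c : Fin S.card × Fin d) (h : JOuter k d S →ₗ[k] Delta k d n A)
    (v : JOuter k d S) : lamOp S c h v =
      delAct k (enum S c.1, c.2) (h v) + h (Jou.del (enum S c.1, c.2) v) := rfl

theorem lamOp_comm (a b : Fin S.card × Fin d) :
    lamOp S a * lamOp S b = lamOp S b * (lamOp S a :
      Module.End k (JOuter k d S →ₗ[k] Delta k d n A)) := by
  ext h v
  simp only [Module.End.mul_apply, lamOp_apply, map_add]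
  rw [delAct_comm, Jou.del_comm]
  abel

/-- The extension of `a ⊗ 1 ↦ f(a ⊠ m ⊗ -)` to `Δ_*^S A` by `𝒟`-linearity. -/
def extend : Delta k d S.card A →ₗ[k] JOuter k d S →ₗ[k] Delta k d n A :=
  Delta.lift (LinearMap.mk₂ k (fun a F => polyAct (lamOp S) (lamOp_comm S) F (outerApp S f m a))
    (by intro a b F; simp) (by intro r a F; simp) (by intro a F G; simp) (by intro r a F; simp))
    (by
      intro s a F
      have key : outerApp S f m (delAct k s a) = ∑ i, lamOp S (i, s) (outerApp S f m a) := by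
        ext v
        have e : (Fin.cons (delAct k s a) m : Fin (Sᶜ.card + 1) → A) =
            Function.update (Fin.cons a m) 0 (delAct k s ((Fin.cons a m : Fin _ → A) 0)) := by
          simp
        rw [outerApp_apply, e, app_update_del, map_add, Delta.push_delAct, restr,
          ← Jou.map_sum_del, sum_collapse, sum_collapse]
        simp [lamOp_apply, outerApp_apply, Finset.sum_add_distrib, restr]
      simp only [LinearMap.mk₂_apply, mul_comm _ F, map_mul, map_sum, Module.End.mul_apply,
        LinearMap.sum_apply, polyAct_X, key])

theorem extend_mk (a : A) (F : MvPolynomial (Fin S.card × Fin d) k) :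
    extend S f m (Delta.mk a F) = polyAct (lamOp S) (lamOp_comm S) F (outerApp S f m a) :=
  Delta.lift_mk _ _ _ _

/-- `h ↦ (v ↦ h(z_i^s v))`, for `i ∈ S`. -/
def mulZ (c : Fin S.card × Fin d) : Module.End k (JOuter k d S →ₗ[k] Delta k d n A) :=
  LinearMap.lcomp k _ (LinearMap.mulLeft k (Jou.gen (.z (enum S c.1) c.2)))

theorem mulZ_apply (c : Fin S.card × Fin d) (h : JOuter k d S →ₗ[k] Delta k d n A)
    (v : JOuter k d S) : mulZ S c h v = h (Jou.gen (.z (enum S c.1) c.2) * v) := rfl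

theorem mulZ_lamOp (c c' : Fin S.card × Fin d) (h : JOuter k d S →ₗ[k] Delta k d n A) :
    mulZ S c (lamOp S c' h) = lamOp S c' (mulZ S c h) + if c = c' then h else 0 := by
  ext v
  have e : ((enum S c.1, c.2) = (enum S c'.1, c'.2)) ↔ c = c' := by
    simp [Prod.ext_iff]
  simp only [mulZ_apply, lamOp_apply, LinearMap.add_apply, Jou.del_z_mul, e, map_add]
  split_ifs <;> simp [mulZ_apply, add_assoc]

theorem mulZ_poly (c : Fin S.card × Fin d) (F : MvPolynomial (Fin S.card × Fin d) k)
    (h : JOuter k d S →ₗ[k] Delta k d n A) :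
    mulZ S c (polyAct (lamOp S) (lamOp_comm S) F h) =
      polyAct (lamOp S) (lamOp_comm S) F (mulZ S c h) +
        polyAct (lamOp S) (lamOp_comm S) (MvPolynomial.pderiv c F) h := by
  classical
  induction F using MvPolynomial.induction_on generalizing h with
  | C r => simp [MvPolynomial.algHom_C]
  | add p q hp hq => simp only [map_add, LinearMap.add_apply, hp, hq]; abel
  | mul_X p c' hp =>
    simp only [Derivation.leibniz, map_add, smul_eq_mul, MvPolynomial.pderiv_X, Pi.single_apply,
      map_mul, Module.End.mul_apply, polyAct_X, LinearMap.add_apply, hp, mulZ_lamOp]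
    have hc : polyAct (lamOp S) (lamOp_comm S) (MvPolynomial.pderiv c p) (lamOp S c' h) =
        lamOp S c' (polyAct (lamOp S) (lamOp_comm S) (MvPolynomial.pderiv c p) h) := by
      rw [← polyAct_X (lamOp S) (lamOp_comm S) c', ← Module.End.mul_apply, ← Module.End.mul_apply,
        ← map_mul, ← map_mul, mul_comm]
    rw [hc]
    by_cases hcc : c = c'
    · simp [hcc]; abel
    · simp [hcc, Ne.symm hcc]

theorem mulZ_outerApp (c : Fin S.card × Fin d) (a : A) :
    mulZ S c (outerApp S f m a : JOuter k d S →ₗ[k] Delta k d n A) =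
      outerApp S f m (zAct k c.2 a) := by
  ext v
  have e : (Fin.cons (zAct k c.2 a) m : Fin (Sᶜ.card + 1) → A) =
      Function.update (Fin.cons a m) 0 (zAct k c.2 ((Fin.cons a m : Fin _ → A) 0)) := by
    simp
  rw [mulZ_apply, outerApp_apply, outerApp_apply, e, app_update_z, map_mul]
  simp [restr, Jou.map, Gen.fam, collapse_enum]

theorem extend_z (c : Fin S.card × Fin d) (y : Delta k d S.card A) (v : JOuter k d S) :
    extend S f m (zAct k c y) v = extend S f m y (Jou.gen (.z (enum S c.1) c.2) * v) := by
  induction y using Delta.induct with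
  | h0 => simp
  | hm a F =>
    rw [Delta.zAct_mk, map_add, extend_mk, extend_mk, extend_mk, ← mulZ_apply, mulZ_poly,
      mulZ_outerApp]
  | ha x y hx hy => simp only [map_add, LinearMap.add_apply, hx, hy]

/-- The parity twist `a ↦ (-1)^{e |a|} a` of the Jouanolou algebra. -/
def twist (e : ℤ) : JConf k d n →ₐ[k] JConf k d n := if Even e then AlgHom.id k _ else Jou.eps

theorem twist_z (e : ℤ) (i : Fin n) (s : Fin d) (a : JConf k d n) :
    twist e (Jou.gen (.z i s) * a) = Jou.gen (.z i s) * twist e a := by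
  unfold twist
  split_ifs
  · rfl
  · exact JSplit.eps_z i s a

/-- The map `u ⊗ v ↦ ± f(g(m_S ⊗ u) ⊠ m_{Sᶜ} ⊗ v)`, see `comp`. -/
def compBilin (e : ℤ) (m : Fin n → A) : JConf k d S.card →ₗ[k] JOuter k d S →ₗ[k] Delta k d n A :=
  extend S f (fun i => m (enum Sᶜ i)) ∘ₗ g.app (fun i => m (enum S i)) ∘ₗ (twist e).toLinearMap

theorem compBilin_z (e : ℤ) (m : Fin n → A) (i : Fin S.card) (s : Fin d) (u : JConf k d S.card)
    (v : JOuter k d S) : compBilin S f g e m (Jou.gen (.z i s) * u) v =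
      compBilin S f g e m u (Jou.gen (.z (enum S i) s) * v) := by
  simp only [compBilin, LinearMap.comp_apply, AlgHom.toLinearMap_apply, twist_z, app_z, extend_z]

/-- The partial composition of the chiral operations `g` (with the inputs in `S`) and `f` (with
the output of `g` as first input, followed by the inputs in `Sᶜ`), evaluated on
`u v ⊗ m`, `u ∈ 𝐉^S`, `v ∈ 𝐉^{(S), Sᶜ}`. Here `e` is the total degree of the inputs in `Sᶜ`, and
the sign `(-1)^{e |u|}` comes from moving `u` past these inputs. The Koszul sign of the
unshuffle of the inputs `m` is not included. -/
def comp (e : ℤ) (m : Fin n → A) : JConf k d n →ₗ[k] Delta k d n A :=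
  JSplit.lift (compBilin S f g e m) (compBilin_z S f g e m) ∘ₗ split k d S

end ChiralOp

end Operad

/-! ### Gradings, differentials and signs -/

/-- The Koszul sign of the permutation `x_1, …, x_n ↦ x_{σ⁻¹(1)}, …, x_{σ⁻¹(n)}` of homogeneous
elements of degrees `deg`. -/
def koszul {n : ℕ} (σ : Equiv.Perm (Fin n)) (deg : Fin n → ℤ) : ℤˣ :=
  ∏ p : Fin n × Fin n with p.1 < p.2 ∧ σ p.2 < σ p.1, (deg p.1 * deg p.2).negOnePow

/-- The antisymmetric Koszul sign of the unshuffle which moves the elements with index in `S` to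
the front. -/
def unshuffle {n : ℕ} (S : Finset (Fin n)) (deg : Fin n → ℤ) : ℤˣ :=
  ∏ p : Fin n × Fin n with p.1 ∈ S ∧ p.2 ∉ S ∧ p.2 < p.1, -(deg p.1 * deg p.2).negOnePow

/-- The sign `χ(S) (-1)^{|S| |Sᶜ|}` of the term of `S` in the `L_∞` relations. -/
def jacobiSign {n : ℕ} (S : Finset (Fin n)) (deg : Fin n → ℤ) : ℤˣ :=
  ((S.card : ℤ) * (Sᶜ.card : ℤ)).negOnePow * unshuffle S deg

/-- The elements of the Jouanolou algebra of cohomological degree `r`: products of `r` elements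
`𝐝x_{ij}^s`, with coefficients in the subalgebra generated by the `z_i^s` and `x_{ij}^s`. -/
def Jou.gr (k : Type u) [Field k] (d : ℕ) {V : Type} (E : V → V → Prop) (r : ℕ) :
    Submodule k (Jou k d E) :=
  Subalgebra.toSubmodule (Algebra.adjoin k
      ({a | ∃ i s, a = Jou.gen (.z i s)} ∪ {a | ∃ i j s, a = Jou.gen (.x i j s)})) *
    Submodule.span k {a | ∃ i j s, a = Jou.gen (.dx i j s)} ^ r

/-- A dg right `𝒟`-module on `𝔸^d`: a right module over the Weyl algebra with a `ℤ`-grading and a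
differential of degree one, both compatible with the action. -/
class DGRightDModule (k : Type u) [Field k] (d : ℕ) (A : Type v) [AddCommGroup A] [Module k A]
    extends RightDModule k (Fin d) A where
  /-- The homogeneous components. -/
  gr : ℤ → Submodule k A
  gr_internal : DirectSum.IsInternal gr
  z_gr : ∀ (c : Fin d) i, ∀ a ∈ gr i, zAct k c a ∈ gr i
  del_gr : ∀ (c : Fin d) i, ∀ a ∈ gr i, delAct k c a ∈ gr i
  /-- The differential. -/
  diff : A →ₗ[k] A
  diff_gr : ∀ i, ∀ a ∈ gr i, diff a ∈ gr (i + 1)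
  diff_diff : ∀ a, diff (diff a) = 0
  diff_z : ∀ (c : Fin d) a, diff (zAct k c a) = zAct k c (diff a)
  diff_del : ∀ (c : Fin d) a, diff (delAct k c a) = delAct k c (diff a)

section DG

variable (k : Type u) [Field k] (d : ℕ) (A : Type v) [AddCommGroup A] [Module k A]
  [DGRightDModule k d A]

/-- The homogeneous components of `A`. -/
def grade (i : ℤ) : Submodule k A := DGRightDModule.gr d i

/-- The differential of `A`. -/
def dA : A →ₗ[k] A := DGRightDModule.diff d

/-- The homogeneous components of `Δ_* A`; the variables `λ` have degree zero. -/
def Delta.gr (n : ℕ) (i : ℤ) : Submodule k (Delta k d n A) :=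
  Submodule.span k {y | ∃ a ∈ grade k d A i, ∃ F, y = Delta.mk a F}

/-- The differential `a ⊗ F ↦ da ⊗ F` of `Δ_* A`. -/
def Delta.diff (n : ℕ) : Delta k d n A →ₗ[k] Delta k d n A :=
  Delta.lift (Delta.mk ∘ₗ dA k d A) (by
    intro s a F
    rw [LinearMap.comp_apply, LinearMap.comp_apply, dA, DGRightDModule.diff_del, Delta.del_mk])

/-! ### Homotopy chiral algebras -/

/-- A homotopy chiral algebra structure on `A` in the Jouanolou model: a map from the operad of
`L_∞` algebras to the operad of chiral operations, given by the images `op n` of the generators,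
`n ≥ 2`, which are antisymmetric of degree `2 - n` and satisfy the `L_∞` relations in the operad of
chiral operations (the differential of `A` being the unary operation). -/
structure HomotopyChiralAlgebra where
  /-- The chiral operation `μ_n : 𝐉^n(A^{⊠ n}) → Δ_* A`. -/
  op : ∀ n : ℕ, ChiralOp k d n A
  op_small : ∀ n, n < 2 → (op n).1 = 0
  op_degree : ∀ (n : ℕ) (deg : Fin n → ℤ) (m : Fin n → A), (∀ i, m i ∈ grade k d A (deg i)) →
    ∀ (r : ℕ), ∀ α ∈ Jou.gr k d (fun i j : Fin n => i ≠ j) r,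
      (op n).app m α ∈ Delta.gr k d A n ((∑ i, deg i) + r + 2 - n)
  op_skew : ∀ (n : ℕ) (deg : Fin n → ℤ) (m : Fin n → A), (∀ i, m i ∈ grade k d A (deg i)) →
    ∀ (σ : Equiv.Perm (Fin n)) (α : JConf k d n),
      koszul σ deg • (op n).app (m ∘ σ.symm) (Jou.map σ (fun _ _ => σ.injective.ne_iff.symm) α) =
        Equiv.Perm.sign σ • Delta.push σ.symm ((op n).app m α)
  op_relation : ∀ (n : ℕ), 2 ≤ n → ∀ (deg : Fin n → ℤ) (m : Fin n → A),
    (∀ i, m i ∈ grade k d A (deg i)) → ∀ α : JConf k d n,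
      Delta.diff k d A n ((op n).app m α) +
        ((n : ℤ) - 1).negOnePow • (
          ∑ i, (∑ j with j < i, deg j).negOnePow •
            (op n).app (Function.update m i (dA k d A (m i))) α +
          (∑ i, deg i).negOnePow • (op n).app m (Jou.diff α)) +
        ∑ S : Finset (Fin n) with 2 ≤ S.card ∧ S.card < n,
          jacobiSign S deg •
            ChiralOp.comp S (op (Sᶜ.card + 1)) (op S.card) (∑ j ∈ Sᶜ, deg j) m α = 0

end DG

/-! ### `L_∞` algebras -/

/-- An `L_∞` algebra structure on a vector space `L` with homogeneous components `gr`: antisymmetric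
brackets `[x_1, …, x_n]` of degree `2 - n`, for `n ≥ 1`, with the relations
`∑_S (-1)^{|S| |Sᶜ|} χ(S) [[x_S], x_{Sᶜ}] = 0`. -/
structure LInftyAlgebra (k : Type u) [Field k] (L : Type v) [AddCommGroup L] [Module k L]
    (gr : ℤ → Submodule k L) where
  gr_internal : DirectSum.IsInternal gr
  /-- The bracket with `n` inputs. -/
  bracket : ∀ n : ℕ, MultilinearMap k (fun _ : Fin n => L) L
  bracket_zero : bracket 0 = 0
  bracket_degree : ∀ (n : ℕ) (deg : Fin n → ℤ) (x : Fin n → L), (∀ i, x i ∈ gr (deg i)) →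
    bracket n x ∈ gr ((∑ i, deg i) + 2 - n)
  bracket_skew : ∀ (n : ℕ) (deg : Fin n → ℤ) (x : Fin n → L), (∀ i, x i ∈ gr (deg i)) →
    ∀ σ : Equiv.Perm (Fin n),
      koszul σ deg • bracket n (x ∘ σ.symm) = Equiv.Perm.sign σ • bracket n x
  jacobi : ∀ (n : ℕ) (deg : Fin n → ℤ) (x : Fin n → L), (∀ i, x i ∈ gr (deg i)) →
    ∑ S : Finset (Fin n) with S.Nonempty,
      jacobiSign S deg • bracket (Sᶜ.card + 1)
        (Fin.cons (bracket S.card (x ∘ enum S)) (x ∘ enum Sᶜ)) = 0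

/-! ### De Rham cohomology -/

section DeRham

variable (k : Type u) [Field k] (C : Type) (N : Type v) [AddCommGroup N] [Module k N]
  [RightDModule k C N]

/-- The relations `n z_c ⊗ f = n ⊗ z_c f` and `n ∂_c ⊗ f = n ⊗ ∂_c f`. -/
def deRhamRel : Submodule k (N ⊗[k] MvPolynomial C k) :=
  Submodule.span k ({y | ∃ (n : N) (c : C) (f : MvPolynomial C k),
      y = zAct k c n ⊗ₜ f - n ⊗ₜ (MvPolynomial.X c * f)} ∪
    {y | ∃ (n : N) (c : C) (f : MvPolynomial C k),
      y = delAct k c n ⊗ₜ f - n ⊗ₜ (MvPolynomial.pderiv c f)})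

/-- The de Rham cohomology `h(N) = N ⊗_𝒟 𝒪` of a right `𝒟`-module on an affine space. -/
def DeRham : Type (max u v) := (N ⊗[k] MvPolynomial C k) ⧸ deRhamRel k C N

instance : AddCommGroup (DeRham k C N) :=
  inferInstanceAs (AddCommGroup ((N ⊗[k] MvPolynomial C k) ⧸ deRhamRel k C N))
instance : Module k (DeRham k C N) :=
  inferInstanceAs (Module k ((N ⊗[k] MvPolynomial C k) ⧸ deRhamRel k C N))

variable {N} in
/-- The class of `n ⊗ f`. -/
def DeRham.mk (n : N) (f : MvPolynomial C k) : DeRham k C N :=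
  (deRhamRel k C N).mkQ (n ⊗ₜ f)

variable {N} in
/-- The class of `n ⊗ 1`. -/
def cls (n : N) : DeRham k C N := DeRham.mk k C n 1

/-- The homogeneous components of `h(A)`. -/
def DeRham.gr (d : ℕ) (A : Type v) [AddCommGroup A] [Module k A] [DGRightDModule k d A] (i : ℤ) :
    Submodule k (DeRham k (Fin d) A) :=
  Submodule.span k {y | ∃ a ∈ grade k d A i, ∃ f, y = DeRham.mk k (Fin d) a f}

end DeRham
end HigherChiral

end

open HigherChiral

/-!
For a right `𝒟`-module `N` every function can be moved into `N`, so `h(N) = N ⊗_𝒟 𝒪` is the quotient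
of `N` by the images of the vector fields `∂_c`: the map `n ↦ [n]` is surjective
(`clsHom_surjective`), and linear maps out of `h(N)` are the linear maps out of `N` which kill all
`n ∂_c` (`DeRham.lift`). For `N = Δ_* A` the vector fields act by multiplication with the `λ_i^s`,
and `a ⊗ F ↦ F(0) [a]` identifies `h(Δ_* A)` with `h(A)` (`Delta.toDeRham`, `Delta.cls_eq_iff`).

The function `1` in the Jouanolou algebra is killed by all `∂_{z_i^s}`, so by `𝒟`-linearity
`μ((… ⊠ a_i ∂_s ⊠ …) ⊗ 1) = μ((… ⊠ a_i ⊠ …) ⊗ 1) ∂_{z_i^s}`. Hence `[μ((a_1 ⊠ ⋯ ⊠ a_n) ⊗ 1)]`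
depends only on the classes of the `a_i` and defines a bracket on `h(A)`. For the same reason the
partial composition of chiral operations, evaluated at `1`, becomes the composition of brackets:
the `𝒟`-linear extension to `Δ_*^S A` turns the `λ_i` into operators which vanish in cohomology at
`1` (`ChiralOp.toDeRham_comp`).

The `L_∞` relations for the brackets are the relations in the chiral operad evaluated at `1`, where
the term with the differential of the Jouanolou algebra vanishes. The subsets `S` with
`2 ≤ |S| < n` give the compositions of operations, `S = {1, …, n}` gives `d ∘ μ_n`, and the
singletons give `μ_n ∘ d`, after the differentiated argument is moved back to its position by the
antisymmetry of the bracket (`jacobiSign_singleton`). The grading of `A` descends to `h(A)` since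
its projections commute with the vector fields (`DeRham.gr_internal`).
-/

noncomputable section

namespace HigherChiral

universe u v w

/-! ### De Rham cohomology as coinvariants of the vector fields -/

section DeRham

variable {k : Type u} [Field k] {C : Type} {N : Type v} [AddCommGroup N] [Module k N]
  [RightDModule k C N]

/-- The action of functions on a right `𝒟`-module, `f ↦ (n ↦ n f)`. -/
def funAct (k : Type u) [Field k] (C : Type) (N : Type v) [AddCommGroup N] [Module k N]
    [RightDModule k C N] : MvPolynomial C k →ₐ[k] Module.End k N :=
  polyAct (fun c => zAct k c) fun a b => LinearMap.ext fun n => zAct_comm k a b n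

theorem funAct_X (c : C) : funAct k C N (MvPolynomial.X c) = zAct k c := polyAct_X _ _ c

/-- The Leibniz rule `n ∂ f = n f ∂ + n (∂f)` in a right `𝒟`-module. -/
theorem funAct_delAct (c : C) (f : MvPolynomial C k) (n : N) :
    funAct k C N f (delAct k c n) =
      delAct k c (funAct k C N f n) + funAct k C N (MvPolynomial.pderiv c f) n := by
  classical
  induction f using MvPolynomial.induction_on generalizing n with
  | C r => simp [MvPolynomial.algHom_C]
  | add p q hp hq => simp only [map_add, LinearMap.add_apply, hp, hq]; abel
  | mul_X p b hp =>
    simp only [map_mul, Module.End.mul_apply, funAct_X, Derivation.leibniz, map_add,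
      smul_eq_mul, MvPolynomial.pderiv_X, Pi.single_apply, LinearMap.add_apply]
    have hc : zAct k b (funAct k C N (MvPolynomial.pderiv c p) n) =
        funAct k C N (MvPolynomial.pderiv c p) (zAct k b n) := by
      rw [← funAct_X, ← Module.End.mul_apply, ← Module.End.mul_apply, ← map_mul, ← map_mul,
        mul_comm]
    by_cases h : b = c
    · subst h
      rw [weyl_same, map_add, hp, hc]
      simp
      abel
    · rw [weyl_ne k h, hp, hc]
      simp [h]

variable (k C N) in
/-- The map `N → h(N)`, `n ↦ [n]`. -/
def clsHom : N →ₗ[k] DeRham k C N :=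
  (deRhamRel k C N).mkQ ∘ₗ (TensorProduct.mk k N (MvPolynomial C k)).flip 1

theorem clsHom_apply (n : N) : clsHom k C N n = cls k C n := rfl

theorem DeRham.mk_eq_cls (n : N) (f : MvPolynomial C k) :
    DeRham.mk k C n f = cls k C (funAct k C N f n) := by
  induction f using MvPolynomial.induction_on generalizing n with
  | C r =>
    simp only [DeRham.mk, cls, MvPolynomial.algHom_C, Module.algebraMap_end_apply]
    rw [TensorProduct.smul_tmul, MvPolynomial.smul_eq_C_mul, mul_one]
  | add p q hp hq =>
    have : DeRham.mk k C n (p + q) = DeRham.mk k C n p + DeRham.mk k C n q := by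
      simp only [DeRham.mk, TensorProduct.tmul_add, map_add]
      rfl
    rw [this, hp, hq, map_add, LinearMap.add_apply, ← clsHom_apply, ← clsHom_apply,
      ← clsHom_apply, map_add]
  | mul_X p c hp =>
    have : DeRham.mk k C n (p * MvPolynomial.X c) = DeRham.mk k C (zAct k c n) p := by
      refine Eq.symm ((Submodule.Quotient.eq _).2 (Submodule.subset_span (Or.inl ⟨n, c, p, ?_⟩)))
      rw [mul_comm]
    rw [this, hp, map_mul, Module.End.mul_apply, funAct_X]

theorem clsHom_surjective : Function.Surjective (clsHom k C N) := by
  intro y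
  obtain ⟨y, rfl⟩ := (deRhamRel k C N).mkQ_surjective y
  induction y using TensorProduct.induction_on with
  | zero => exact ⟨0, (map_zero _).trans (map_zero _).symm⟩
  | tmul n f => exact ⟨funAct k C N f n, (DeRham.mk_eq_cls n f).symm⟩
  | add x y hx hy =>
    obtain ⟨a, ha⟩ := hx
    obtain ⟨b, hb⟩ := hy
    exact ⟨a + b, by rw [map_add, map_add, ha, hb]; rfl⟩

theorem cls_delAct (c : C) (n : N) : cls k C (delAct k c n) = 0 := by
  refine (Submodule.Quotient.mk_eq_zero _).2 (Submodule.subset_span (Or.inr ⟨n, c, 1, ?_⟩))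
  simp

/-- A linear map which kills the vector fields factors through de Rham cohomology. -/
def DeRham.lift {M : Type w} [AddCommGroup M] [Module k M] (g : N →ₗ[k] M)
    (hg : ∀ (c : C) n, g (delAct k c n) = 0) : DeRham k C N →ₗ[k] M :=
  (deRhamRel k C N).liftQ
    (TensorProduct.lift ((funAct k C N).toLinearMap.flip.compr₂ g)) (by
      rw [deRhamRel, Submodule.span_le]
      rintro _ (⟨n, c, f, rfl⟩ | ⟨n, c, f, rfl⟩)
      · simp [mul_comm _ f, funAct_X]
      · simp [funAct_delAct, hg])

@[simp] theorem DeRham.lift_cls {M : Type w} [AddCommGroup M] [Module k M] (g : N →ₗ[k] M)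
    (hg : ∀ (c : C) n, g (delAct k c n) = 0) (n : N) : DeRham.lift g hg (cls k C n) = g n := by
  simp only [lift, cls, DeRham.mk]
  erw [Submodule.liftQ_apply]
  simp

/-- A multilinear map which kills the vector fields in each argument depends on the arguments only
through their de Rham classes. -/
theorem multilinear_congr_cls {M : Type w} [AddCommGroup M] [Module k M] {n : ℕ}
    (G : MultilinearMap k (fun _ : Fin n => N) M)
    (hG : ∀ (m : Fin n → N) i (c : C) a, G (Function.update m i (delAct k c a)) = 0)
    {a b : Fin n → N} (h : ∀ i, cls k C (a i) = cls k C (b i)) : G a = G b := by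
  -- Replace the arguments `b j` by `a j` one at a time, for `j` in a growing set `s`.
  have key : ∀ s : Finset (Fin n), G (s.piecewise a b) = G b := by
    intro s
    induction s using Finset.induction_on with
    | empty => simp
    | insert j s hj ih =>
      rw [Finset.piecewise_insert]
      let g := DeRham.lift (G.toLinearMap (s.piecewise a b) j) (fun c n => hG _ j c n)
      have e : ∀ x, G (Function.update (s.piecewise a b) j x) = g (cls k C x) := fun x =>
        (DeRham.lift_cls (G.toLinearMap (s.piecewise a b) j) (fun c n => hG _ j c n) x).symm
      rw [e, h, ← e, ← ih]
      congr 1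
      simp [hj]
  simpa using key Finset.univ

/-- The map induced on de Rham cohomology by a multilinear map which kills the vector fields in
each argument; it is evaluated on representatives chosen by a linear section of `N → h(N)`. -/
def DeRham.multilift {M : Type w} [AddCommGroup M] [Module k M] {n : ℕ}
    (G : MultilinearMap k (fun _ : Fin n => N) M) :
    MultilinearMap k (fun _ : Fin n => DeRham k C N) M :=
  G.compLinearMap fun _ => ((clsHom k C N).exists_rightInverse_of_surjective
    (LinearMap.range_eq_top.2 clsHom_surjective)).choose

theorem DeRham.multilift_cls {M : Type w} [AddCommGroup M] [Module k M] {n : ℕ}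
    (G : MultilinearMap k (fun _ : Fin n => N) M)
    (hG : ∀ (m : Fin n → N) i (c : C) a, G (Function.update m i (delAct k c a)) = 0)
    (a : Fin n → N) : DeRham.multilift G (fun i => cls k C (a i)) = G a :=
  multilinear_congr_cls G hG fun i => LinearMap.congr_fun
    ((clsHom k C N).exists_rightInverse_of_surjective
      (LinearMap.range_eq_top.2 clsHom_surjective)).choose_spec (cls k C (a i))

end DeRham

/-! ### Cohomology of the push-forward along the diagonal -/

section Delta

variable {k : Type u} [Field k] {d n : ℕ} {A : Type v} [AddCommGroup A] [Module k A]
  [RightDModule k (Fin d) A]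

variable (k d n A) in
/-- The map `Δ_* A → h(A)`, `a ⊗ F ↦ F(0) [a]`, which induces `h(Δ_* A) ≅ h(A)`. -/
def Delta.toDeRham : Delta k d n A →ₗ[k] DeRham k (Fin d) A :=
  Delta.lift (LinearMap.mk₂ k (fun a F => MvPolynomial.constantCoeff F • cls k (Fin d) a)
    (by intro a b F; rw [← clsHom_apply, map_add, smul_add]; rfl)
    (by intro r a F; rw [← clsHom_apply, map_smul, smul_comm]; rfl)
    (by intro a F G; rw [map_add, add_smul])
    (by intro r a F; simp [MvPolynomial.constantCoeff_smul, mul_smul]))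
    (by intro s a F; simp [cls_delAct])

@[simp] theorem Delta.toDeRham_mk (a : A) (F : MvPolynomial (Fin n × Fin d) k) :
    Delta.toDeRham k d n A (Delta.mk a F) = MvPolynomial.constantCoeff F • cls k (Fin d) a := by
  simp [Delta.toDeRham]

theorem Delta.toDeRham_delAct (c : Fin n × Fin d) (y : Delta k d n A) :
    Delta.toDeRham k d n A (delAct k c y) = 0 := by
  induction y using Delta.induct with
  | h0 => simp
  | hm a F => simp
  | ha x y hx hy => simp [hx, hy]

theorem Delta.toDeRham_push {m : ℕ} (r : Fin n → Fin m) (y : Delta k d m A) :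
    Delta.toDeRham k d n A (Delta.push r y) = Delta.toDeRham k d m A y := by
  induction y using Delta.induct with
  | h0 => simp
  | hm a F =>
    simp only [Delta.push, Delta.lift_mk, LinearMap.compl₂_apply, AlgHom.toLinearMap_apply,
      toDeRham_mk]
    congr 1
    induction F using MvPolynomial.induction_on with
    | C r => simp
    | add p q hp hq => simp only [map_add, hp, hq]
    | mul_X p c hp => simp
  | ha x y hx hy => simp only [map_add, hx, hy]

/-- Modulo the vector fields, `a ⊗ F` is `a ⊗ F(0)`. -/
theorem Delta.cls_mk (a : A) (F : MvPolynomial (Fin n × Fin d) k) :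
    cls k (Fin n × Fin d) (Delta.mk a F : Delta k d n A) =
      MvPolynomial.constantCoeff F • cls k (Fin n × Fin d) (Delta.mk a 1 : Delta k d n A) := by
  induction F using MvPolynomial.induction_on with
  | C r =>
    rw [MvPolynomial.constantCoeff_C, ← clsHom_apply, ← clsHom_apply, ← map_smul, ← map_smul,
      MvPolynomial.smul_eq_C_mul, mul_one]
  | add p q hp hq =>
    rw [map_add, map_add, ← clsHom_apply, map_add, clsHom_apply, clsHom_apply, hp, hq, add_smul]
  | mul_X p c hp =>
    rw [mul_comm, ← Delta.delAct_mk, cls_delAct]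
    simp

theorem Delta.cls_mk_one_delAct (s : Fin d) (a : A) :
    cls k (Fin n × Fin d) (Delta.mk (delAct k s a) 1 : Delta k d n A) = 0 := by
  rw [Delta.del_mk, Delta.cls_mk]
  simp

/-- The isomorphism `h(Δ_* A) ≅ h(A)`, in the form in which it is used. -/
theorem Delta.cls_eq_iff (x y : Delta k d n A) :
    cls k (Fin n × Fin d) x = cls k (Fin n × Fin d) y ↔
      Delta.toDeRham k d n A x = Delta.toDeRham k d n A y := by
  constructor
  · intro h
    have := congrArg (DeRham.lift (Delta.toDeRham k d n A) Delta.toDeRham_delAct) h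
    simpa using this
  · -- `[a] ↦ [a ⊗ 1]` is a left inverse of the map on `h(Δ_* A)` induced by `toDeRham`.
    let g : DeRham k (Fin d) A →ₗ[k] DeRham k (Fin n × Fin d) (Delta k d n A) :=
      DeRham.lift (clsHom k (Fin n × Fin d) _ ∘ₗ Delta.mk.flip 1)
        (fun s a => Delta.cls_mk_one_delAct s a)
    have hg : ∀ x, g (Delta.toDeRham k d n A x) = cls k (Fin n × Fin d) x := by
      intro x
      induction x using Delta.induct with
      | h0 => rw [map_zero, map_zero, ← clsHom_apply, map_zero]
      | hm a F =>
        rw [Delta.toDeRham_mk, map_smul, Delta.cls_mk a F]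
        exact congrArg _ (DeRham.lift_cls _ _ a)
      | ha x y hx hy => rw [map_add, map_add, hx, hy]; exact (map_add (clsHom k _ _) x y).symm
    intro h
    rw [← hg, ← hg, h]

end Delta

/-! ### The grading of the cohomology -/

section Graded

variable {k : Type u} [Field k] {d : ℕ} {A : Type v} [AddCommGroup A] [Module k A]
  [DGRightDModule k d A]

theorem funAct_mem_grade (f : MvPolynomial (Fin d) k) {i : ℤ} {a : A} (ha : a ∈ grade k d A i) :
    funAct k (Fin d) A f a ∈ grade k d A i := by
  induction f using MvPolynomial.induction_on generalizing a with
  | C r =>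
    rw [MvPolynomial.algHom_C, Module.algebraMap_end_apply]
    exact Submodule.smul_mem _ _ ha
  | add p q hp hq =>
    rw [map_add, LinearMap.add_apply]
    exact add_mem (hp ha) (hq ha)
  | mul_X p c hp =>
    rw [map_mul, Module.End.mul_apply, funAct_X]
    exact hp (DGRightDModule.z_gr c i a ha)

theorem DeRham.gr_eq_map (i : ℤ) :
    DeRham.gr k d A i = (grade k d A i).map (clsHom k (Fin d) A) := by
  refine le_antisymm (Submodule.span_le.2 ?_) ?_
  · rintro _ ⟨a, ha, f, rfl⟩
    exact ⟨_, funAct_mem_grade f ha, (DeRham.mk_eq_cls a f).symm⟩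
  · rintro _ ⟨a, ha, rfl⟩
    exact Submodule.subset_span ⟨a, ha, 1, rfl⟩

theorem DeRham.mem_gr_iff {i : ℤ} {x : DeRham k (Fin d) A} :
    x ∈ DeRham.gr k d A i ↔ ∃ a ∈ grade k d A i, cls k (Fin d) a = x := by
  rw [DeRham.gr_eq_map]
  rfl

theorem DeRham.gr_internal : DirectSum.IsInternal (DeRham.gr k d A) := by
  classical
  let _ : DirectSum.Decomposition (grade k d A) :=
    DirectSum.IsInternal.chooseDecomposition _ (DGRightDModule.gr_internal (k := k) (d := d))
  -- `p i` is the projection of `A` to degree `i`, `P i` the induced projection of `h(A)`.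
  let p : ℤ → A →ₗ[k] A := fun i => (grade k d A i).subtype ∘ₗ
    DirectSum.component k ℤ (fun i => grade k d A i) i ∘ₗ
      (DirectSum.decomposeLinearEquiv (grade k d A)).toLinearMap
  have hp : ∀ i j, ∀ a ∈ grade k d A j, p i a = if j = i then a else 0 := by
    intro i j a ha
    split_ifs with h
    · subst h; exact DirectSum.decompose_of_mem_same _ ha
    · exact DirectSum.decompose_of_mem_ne _ ha h
  have hind : ∀ {P : A → Prop}, P 0 → (∀ i, ∀ a ∈ grade k d A i, P a) →
      (∀ x y, P x → P y → P (x + y)) → ∀ a, P a := fun h0 h1 h2 a =>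
    DirectSum.Decomposition.inductionOn (grade k d A) h0 (fun {i} m => h1 i m m.2) h2 a
  have hdel : ∀ i (s : Fin d) a, p i (delAct k s a) = delAct k s (p i a) := by
    intro i s
    refine hind (by simp) (fun j a ha => ?_) fun x y hx hy => by simp only [map_add, hx, hy]
    rw [hp i j a ha, hp i j _ (DGRightDModule.del_gr s j a ha)]
    split_ifs <;> simp
  let P : ℤ → DeRham k (Fin d) A →ₗ[k] DeRham k (Fin d) A := fun i =>
    DeRham.lift (clsHom k (Fin d) A ∘ₗ p i) fun s a => by
      rw [LinearMap.comp_apply, hdel, clsHom_apply, cls_delAct]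
  have hP : ∀ i j, ∀ y ∈ DeRham.gr k d A j, P i y = if j = i then y else 0 := by
    intro i j y hy
    obtain ⟨a, ha, rfl⟩ := DeRham.mem_gr_iff.1 hy
    refine (DeRham.lift_cls _ _ a).trans ?_
    rw [LinearMap.comp_apply, hp i j a ha, clsHom_apply]
    split_ifs
    · rfl
    · rw [← clsHom_apply, map_zero]
  constructor
  · refine (injective_iff_map_eq_zero _).2 fun y hy => ?_
    have key : ∀ (y : DirectSum ℤ fun i => DeRham.gr k d A i) i,
        P i (DirectSum.coeAddMonoidHom (DeRham.gr k d A) y) = y i := by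
      intro y i
      induction y using DirectSum.induction_on with
      | zero => simp
      | of j a =>
        rw [DirectSum.coeAddMonoidHom_of, hP i j a a.2]
        split_ifs with h
        · subst h; rw [DirectSum.of_eq_same]
        · rw [DirectSum.of_eq_of_ne _ _ _ (Ne.symm h)]; rfl
      | add x y hx hy => rw [map_add, map_add, hx, hy]; rfl
    ext i
    rw [← key y i, hy, map_zero]
    rfl
  · intro y
    obtain ⟨a, rfl⟩ := clsHom_surjective y
    refine hind (P := fun a => ∃ y, DirectSum.coeAddMonoidHom (DeRham.gr k d A) y =
      clsHom k (Fin d) A a) ⟨0, by simp⟩ (fun i a ha => ?_) (fun x y hx hy => ?_) a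
    · exact ⟨DirectSum.of _ i ⟨_, DeRham.mem_gr_iff.2 ⟨a, ha, rfl⟩⟩,
        DirectSum.coeAddMonoidHom_of _ _ _⟩
    · obtain ⟨u, hu⟩ := hx
      obtain ⟨v, hv⟩ := hy
      exact ⟨u + v, by rw [map_add, map_add, hu, hv]⟩

end Graded

/-! ### The bracket of a chiral operation -/

namespace ChiralOp

variable {k : Type u} [Field k] {d n : ℕ} {A : Type v} [AddCommGroup A] [Module k A]
  [RightDModule k (Fin d) A]

/-- The multilinear map `(a_1, …, a_n) ↦ [f((a_1 ⊠ ⋯ ⊠ a_n) ⊗ 1)]` with values in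
`h(Δ_* A) = h(A)`. -/
def form (f : ChiralOp k d n A) : MultilinearMap k (fun _ : Fin n => A) (DeRham k (Fin d) A) :=
  (Delta.toDeRham k d n A ∘ₗ f.1 ∘ₗ JModel.mk.flip 1).compMultilinearMap (PiTensorProduct.tprod k)

theorem form_apply (f : ChiralOp k d n A) (a : Fin n → A) :
    f.form a = Delta.toDeRham k d n A (f.app a 1) := rfl

theorem form_update_del (f : ChiralOp k d n A) (m : Fin n → A) (i : Fin n) (s : Fin d) (a : A) :
    f.form (Function.update m i (delAct k s a)) = 0 := by
  have e : Function.update m i (delAct k s a) = Function.update (Function.update m i a) i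
      (delAct k s (Function.update m i a i)) := by simp
  rw [e, form_apply, app_update_del, Jou.del_one, map_zero, add_zero, Delta.toDeRham_delAct]

section Comp

variable (S : Finset (Fin n)) (f : ChiralOp k d (Sᶜ.card + 1) A) (g : ChiralOp k d S.card A)

/-- Modulo the vector fields, a polynomial in the `λ_i`, `i ∈ S`, acts on `f(a ⊠ m ⊗ -)` at the
constant function `1` through its constant term, since `∂_{z_i} 1 = 0`. -/
theorem toDeRham_polyAct_lamOp (F : MvPolynomial (Fin S.card × Fin d) k)
    (h : JOuter k d S →ₗ[k] Delta k d n A) :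
    Delta.toDeRham k d n A (polyAct (lamOp S) (lamOp_comm S) F h 1) =
      MvPolynomial.constantCoeff F • Delta.toDeRham k d n A (h 1) := by
  induction F using MvPolynomial.induction_on generalizing h with
  | C r => simp [MvPolynomial.algHom_C]
  | add p q hp hq => simp only [map_add, LinearMap.add_apply, hp, hq, add_smul]
  | mul_X p c hp =>
    rw [map_mul, Module.End.mul_apply, hp, polyAct_X, lamOp_apply, Jou.del_one, map_zero,
      add_zero, Delta.toDeRham_delAct]
    simp

/-- The `𝒟`-linear extension of `a ↦ f(a ⊠ m ⊗ -)` to `Δ_*^S A`, evaluated at `1`, induces the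
bracket of `f` on cohomology. -/
theorem toDeRham_extend (m : Fin Sᶜ.card → A) (y : Delta k d S.card A) (b : A)
    (hb : Delta.toDeRham k d _ A y = cls k (Fin d) b) :
    Delta.toDeRham k d n A (extend S f m y 1) = f.form (Fin.cons b m) := by
  let e : A →ₗ[k] DeRham k (Fin d) A :=
    Delta.toDeRham k d n A ∘ₗ LinearMap.applyₗ 1 ∘ₗ outerApp S f m
  have he : ∀ a, e a = f.form (Fin.cons a m) := by
    intro a
    simp only [e, LinearMap.comp_apply, LinearMap.applyₗ_apply_apply, outerApp_apply, map_one,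
      Delta.toDeRham_push, form_apply]
  have hd : ∀ (s : Fin d) a, e (delAct k s a) = 0 := by
    intro s a
    rw [he, ← form_update_del f (Fin.cons a m) 0 s a, Fin.update_cons_zero]
  have key : ∀ y, Delta.toDeRham k d n A (extend S f m y 1) =
      DeRham.lift e hd (Delta.toDeRham k d _ A y) := by
    intro y
    induction y using Delta.induct with
    | h0 => simp
    | hm a F =>
      rw [extend_mk, toDeRham_polyAct_lamOp, Delta.toDeRham_mk, map_smul]
      exact congrArg _ (DeRham.lift_cls e hd a).symm
    | ha x y hx hy => simp only [map_add, LinearMap.add_apply, hx, hy]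
  rw [key, hb, ← he]
  exact DeRham.lift_cls e hd b

/-- On de Rham cohomology the composition of chiral operations is the composition of brackets. -/
theorem toDeRham_comp (e : ℤ) (m : Fin n → A) (b : A)
    (hb : g.form (fun i => m (enum S i)) = cls k (Fin d) b) :
    Delta.toDeRham k d n A (comp S f g e m 1) = f.form (Fin.cons b fun i => m (enum Sᶜ i)) := by
  have h : comp S f g e m 1 = extend S f (fun i => m (enum Sᶜ i))
      (g.app (fun i => m (enum S i)) 1) 1 := by
    simp [comp, split, compBilin]
  rw [h]
  exact toDeRham_extend S f _ _ b hb

end Comp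

end ChiralOp

/-! ### Signs -/

section Signs

theorem negOnePow_sum {ι : Type} (s : Finset ι) (f : ι → ℤ) :
    (∑ i ∈ s, f i).negOnePow = ∏ i ∈ s, (f i).negOnePow := by
  classical
  induction s using Finset.induction_on with
  | empty => simp
  | insert j s hj ih => rw [Finset.sum_insert hj, Finset.prod_insert hj, Int.negOnePow_add, ih]

/-- The inversions of the cycle which moves `i` to the front are the pairs `(j, i)` with `j < i`. -/
theorem koszul_cycleRange {p : ℕ} (i : Fin (p + 1)) (deg : Fin (p + 1) → ℤ) :
    koszul i.cycleRange deg = ∏ j with j < i, (deg j * deg i).negOnePow := by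
  have hinv : ∀ j l : Fin (p + 1),
      (j < l ∧ i.cycleRange l < i.cycleRange j) ↔ (l = i ∧ j < i) := by
    intro j l
    constructor
    · rintro ⟨h1, h2⟩
      rcases lt_trichotomy l i with h | h | h
      · rw [Fin.lt_def, Fin.coe_cycleRange_of_lt h, Fin.coe_cycleRange_of_lt (h1.trans h)] at h2
        omega
      · exact ⟨h, h ▸ h1⟩
      · rw [Fin.cycleRange_of_gt h] at h2
        rcases le_or_gt j i with h' | h'
        · have := Fin.coe_cycleRange_of_le h'
          rw [Fin.lt_def, this] at h2
          split_ifs at h2 <;> omega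
        · rw [Fin.cycleRange_of_gt h'] at h2
          exact absurd h1 h2.not_gt
    · rintro ⟨rfl, h⟩
      refine ⟨h, ?_⟩
      rw [Fin.cycleRange_self, Fin.lt_def, Fin.coe_cycleRange_of_lt h]
      simp
  unfold koszul
  refine Finset.prod_bij' (fun q _ => q.1) (fun j _ => (j, i)) ?_ ?_ ?_ ?_ ?_
  · intro q hq
    simpa using ((hinv _ _).1 (Finset.mem_filter.1 hq).2).2
  · intro j hj
    simpa using (hinv j i).2 ⟨rfl, (Finset.mem_filter.1 hj).2⟩
  · intro q hq
    exact Prod.ext rfl ((hinv _ _).1 (Finset.mem_filter.1 hq).2).1.symm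
  · intro j hj
    rfl
  · intro q hq
    rw [((hinv _ _).1 (Finset.mem_filter.1 hq).2).1]

theorem unshuffle_singleton {n : ℕ} (i : Fin n) (deg : Fin n → ℤ) :
    unshuffle {i} deg = ∏ j with j < i, -(deg i * deg j).negOnePow := by
  unfold unshuffle
  refine Finset.prod_bij' (fun q _ => q.2) (fun j _ => (i, j)) ?_ ?_ ?_ ?_ ?_
  · intro q hq
    obtain ⟨h1, -, h2⟩ := (Finset.mem_filter.1 hq).2
    rw [Finset.mem_singleton.1 h1] at h2
    simpa using h2
  · intro j hj
    have := (Finset.mem_filter.1 hj).2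
    simpa [this] using this.ne
  · intro q hq
    exact Prod.ext (Finset.mem_singleton.1 (Finset.mem_filter.1 hq).2.1).symm rfl
  · intro j hj
    rfl
  · intro q hq
    rw [Finset.mem_singleton.1 (Finset.mem_filter.1 hq).2.1]

theorem unshuffle_univ {n : ℕ} (deg : Fin n → ℤ) : unshuffle Finset.univ deg = 1 := by
  simp [unshuffle]

theorem jacobiSign_univ {n : ℕ} (deg : Fin n → ℤ) : jacobiSign Finset.univ deg = 1 := by
  simp [jacobiSign, unshuffle_univ]

/-- The sign of moving the argument `i` to the front, increasing its degree by one and moving it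
back is the sign of applying an operator of degree one to it. -/
theorem jacobiSign_singleton {p : ℕ} (i : Fin (p + 1)) (deg : Fin (p + 1) → ℤ) :
    jacobiSign {i} deg * (koszul i.cycleRange (Function.update deg i (deg i + 1)) *
      Equiv.Perm.sign i.cycleRange) =
      (((p + 1 : ℕ) : ℤ) - 1).negOnePow * (∑ j with j < i, deg j).negOnePow := by
  have hs : Equiv.Perm.sign i.cycleRange = ∏ j : Fin (p + 1) with j < i, (-1 : ℤˣ) := by
    rw [Fin.sign_cycleRange, Finset.prod_const]
    congr 1
    have : (Finset.univ.filter fun j => j < i) = Finset.Iio i := by ext; simp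
    rw [this, Fin.card_Iio]
  have hc : (({i} : Finset (Fin (p + 1))).card : ℤ) * (({i} : Finset (Fin (p + 1)))ᶜ.card : ℤ) =
      ((p + 1 : ℕ) : ℤ) - 1 := by
    rw [Finset.card_compl, Finset.card_singleton, Fintype.card_fin]
    simp
  rw [jacobiSign, hc, unshuffle_singleton, koszul_cycleRange, hs, negOnePow_sum, mul_assoc,
    ← Finset.prod_mul_distrib, ← Finset.prod_mul_distrib]
  congr 1
  refine Finset.prod_congr rfl fun j hj => ?_
  have hj : j ≠ i := (Finset.mem_filter.1 hj).2.ne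
  rw [Function.update_self, Function.update_of_ne hj, mul_add, mul_one, Int.negOnePow_add,
    mul_comm (deg j), mul_neg_one, mul_neg, neg_mul, neg_neg, ← mul_assoc, Int.units_mul_self,
    one_mul]

end Signs

/-! ### The sum over subsets -/

section Subsets

variable {n : ℕ}

/-- The splitting of the `L_∞` relations into `d ∘ μ_n`, `μ_n ∘ d` and the proper compositions. -/
theorem sum_nonempty_eq {M : Type w} [AddCommMonoid M] (hn : 2 ≤ n) (T : Finset (Fin n) → M) :
    ∑ S : Finset (Fin n) with S.Nonempty, T S =
      T Finset.univ + ∑ i, T {i} + ∑ S : Finset (Fin n) with 2 ≤ S.card ∧ S.card < n, T S := by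
  have hu : ∀ S : Finset (Fin n), S = Finset.univ ↔ S.card = n := fun S => by
    rw [← Finset.card_eq_iff_eq_univ, Fintype.card_fin]
  have h1 : (Finset.univ.filter fun S : Finset (Fin n) => S.Nonempty) =
      {Finset.univ} ∪ Finset.univ.image (fun i : Fin n => {i}) ∪
        Finset.univ.filter fun S : Finset (Fin n) => 2 ≤ S.card ∧ S.card < n := by
    ext S
    have hs : (∃ i, {i} = S) ↔ S.card = 1 := by
      rw [Finset.card_eq_one]
      exact exists_congr fun _ => eq_comm
    have := S.card_le_univ
    rw [Fintype.card_fin] at this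
    simp only [Finset.mem_filter, Finset.mem_univ, true_and, Finset.mem_union,
      Finset.mem_singleton, Finset.mem_image, hs, hu, ← Finset.card_pos]
    omega
  rw [h1, Finset.sum_union, Finset.sum_union, Finset.sum_singleton, Finset.sum_image]
  · intro i _ j _ h
    exact Finset.singleton_injective h
  · rw [Finset.disjoint_left]
    intro S hS hS'
    obtain ⟨i, -, rfl⟩ := Finset.mem_image.1 hS'
    rw [Finset.mem_singleton, hu, Finset.card_singleton] at hS
    omega
  · rw [Finset.disjoint_left]
    intro S hS hS'
    have h2 := (Finset.mem_filter.1 hS').2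
    rcases Finset.mem_union.1 hS with h | h
    · rw [Finset.mem_singleton, hu] at h
      omega
    · obtain ⟨i, -, rfl⟩ := Finset.mem_image.1 h
      rw [Finset.card_singleton] at h2
      omega

theorem enum_univ (j : Fin (Finset.univ : Finset (Fin n)).card) :
    enum Finset.univ j = Fin.cast (Finset.card_fin n) j := by
  refine (congrFun (Finset.orderEmbOfFin_unique (s := Finset.univ) rfl
    (f := Fin.cast (Finset.card_fin n)) (fun _ => Finset.mem_univ _) ?_) j).symm
  exact fun a b h => h

theorem card_compl_singleton_fin {p : ℕ} (i : Fin (p + 1)) :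
    ({i} : Finset (Fin (p + 1)))ᶜ.card = p := by
  rw [Finset.card_compl, Finset.card_singleton, Fintype.card_fin, Nat.add_sub_cancel]

theorem enum_compl_singleton {p : ℕ} (i : Fin (p + 1))
    (j : Fin ({i} : Finset (Fin (p + 1)))ᶜ.card) :
    enum {i}ᶜ j = i.succAbove (Fin.cast (card_compl_singleton_fin i) j) := by
  refine (congrFun (Finset.orderEmbOfFin_unique (s := {i}ᶜ) rfl
    (f := fun j => i.succAbove (Fin.cast (card_compl_singleton_fin i) j)) (fun _ => ?_) ?_) j).symm
  · simp [Fin.succAbove_ne]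
  · exact fun a b h => i.strictMono_succAbove h

/-- Compares members of a family of multilinear maps whose arities agree only propositionally, such
as `|{i}ᶜ| + 1` and `n`. -/
theorem multilinear_cast {k : Type u} [Field k] {L : Type v} [AddCommGroup L] [Module k L]
    {M : Type w} [AddCommGroup M] [Module k M]
    (B : ∀ n : ℕ, MultilinearMap k (fun _ : Fin n => L) M) {m n : ℕ} (h : m = n)
    (y : Fin m → L) (x : Fin n → L) (hxy : ∀ i, y i = x (Fin.cast h i)) : B m y = B n x := by
  subst h
  exact congrArg _ (funext hxy)

end Subsets

/-! ### The brackets of a homotopy chiral algebra -/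

namespace HomotopyChiralAlgebra

variable {k : Type u} [Field k] {d : ℕ} {A : Type v} [AddCommGroup A] [Module k A]
  [DGRightDModule k d A] (X : HomotopyChiralAlgebra k d A)

/-- The multilinear maps on `A` which induce the brackets: zero in arity zero, `a ↦ [da]` in arity
one and `a ↦ [μ_n(a ⊗ 1)]` in higher arity. -/
def form : ∀ n : ℕ, MultilinearMap k (fun _ : Fin n => A) (DeRham k (Fin d) A)
  | 0 => 0
  | 1 => MultilinearMap.ofSubsingleton k A _ (0 : Fin 1) (clsHom k (Fin d) A ∘ₗ dA k d A)
  | n + 2 => (X.op (n + 2)).form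

theorem dA_mem_grade {i : ℤ} {a : A} (ha : a ∈ grade k d A i) :
    dA k d A a ∈ grade k d A (i + 1) := DGRightDModule.diff_gr i a ha

theorem form_one (a : Fin 1 → A) : X.form 1 a = cls k (Fin d) (dA k d A (a 0)) := rfl

theorem form_of_two_le {n : ℕ} (hn : 2 ≤ n) : X.form n = (X.op n).form := by
  obtain ⟨m, rfl⟩ := Nat.exists_eq_add_of_le' hn
  rfl

theorem form_update_del (n : ℕ) (m : Fin n → A) (i : Fin n) (s : Fin d) (a : A) :
    X.form n (Function.update m i (delAct k s a)) = 0 := by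
  match n with
  | 0 => exact i.elim0
  | 1 =>
    obtain rfl : i = 0 := Subsingleton.elim _ _
    rw [form_one, Function.update_self]
    exact (congrArg _ (DGRightDModule.diff_del s a)).trans (cls_delAct s _)
  | n + 2 => exact ChiralOp.form_update_del _ m i s a

theorem form_degree (n : ℕ) (deg : Fin n → ℤ) (m : Fin n → A)
    (hm : ∀ i, m i ∈ grade k d A (deg i)) :
    X.form n m ∈ DeRham.gr k d A ((∑ i, deg i) + 2 - n) := by
  match n with
  | 0 => exact zero_mem _
  | 1 =>
    refine DeRham.mem_gr_iff.2 ⟨_, ?_, rfl⟩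
    have e : (∑ i, deg i) + 2 - ((1 : ℕ) : ℤ) = deg 0 + 1 := by
      rw [Fin.sum_univ_one, Nat.cast_one]
      ring
    exact e ▸ dA_mem_grade (hm 0)
  | n + 2 =>
    have h1 : (1 : JConf k d (n + 2)) ∈ Jou.gr k d (fun i j : Fin (n + 2) => i ≠ j) 0 := by
      rw [Jou.gr, pow_zero, mul_one]
      exact one_mem (Algebra.adjoin k _)
    have h2 := X.op_degree (n + 2) deg m hm 0 1 h1
    rw [Nat.cast_zero, add_zero] at h2
    have h3 : ∀ i, Delta.gr k d A (n + 2) i ≤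
        (DeRham.gr k d A i).comap (Delta.toDeRham k d (n + 2) A) := by
      intro i
      refine Submodule.span_le.2 ?_
      rintro _ ⟨a, ha, F, rfl⟩
      rw [SetLike.mem_coe, Submodule.mem_comap, Delta.toDeRham_mk]
      exact Submodule.smul_mem _ _ (DeRham.mem_gr_iff.2 ⟨a, ha, rfl⟩)
    exact h3 _ h2

theorem form_skew (n : ℕ) (deg : Fin n → ℤ) (m : Fin n → A)
    (hm : ∀ i, m i ∈ grade k d A (deg i)) (σ : Equiv.Perm (Fin n)) :
    koszul σ deg • X.form n (m ∘ σ.symm) = Equiv.Perm.sign σ • X.form n m := by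
  match n with
  | 0 => exact (smul_zero _).trans (smul_zero _).symm
  | 1 =>
    obtain rfl : σ = 1 := Subsingleton.elim _ _
    have : koszul (1 : Equiv.Perm (Fin 1)) deg = 1 := by
      refine Finset.prod_eq_one fun p hp => ?_
      exact absurd (Finset.mem_filter.1 hp).2.1 (by simp [Subsingleton.elim p.1 p.2])
    rw [this, map_one]
    rfl
  | n + 2 =>
    have h := congrArg (Delta.toDeRham k d (n + 2) A) (X.op_skew (n + 2) deg m hm σ 1)
    simp only [map_one, Units.smul_def, map_zsmul, Delta.toDeRham_push] at h
    exact h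

/-- The differential of `h(A)`, induced by that of `A`. -/
def dDeRham (k : Type u) [Field k] (d : ℕ) (A : Type v) [AddCommGroup A] [Module k A]
    [DGRightDModule k d A] : DeRham k (Fin d) A →ₗ[k] DeRham k (Fin d) A :=
  DeRham.lift (clsHom k (Fin d) A ∘ₗ dA k d A) fun s a =>
    (congrArg _ (DGRightDModule.diff_del s a)).trans (cls_delAct s _)

theorem dDeRham_cls (a : A) : dDeRham k d A (cls k (Fin d) a) = cls k (Fin d) (dA k d A a) :=
  DeRham.lift_cls _ _ a

theorem toDeRham_diff (n : ℕ) (y : Delta k d n A) :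
    Delta.toDeRham k d n A (Delta.diff k d A n y) = dDeRham k d A (Delta.toDeRham k d n A y) := by
  induction y using Delta.induct with
  | h0 => simp
  | hm a F => simp [Delta.diff, dDeRham_cls]
  | ha x y hx hy => simp only [map_add, hx, hy]

/-- The `n`-th bracket on `h(A)`. -/
def bracket (n : ℕ) :
    MultilinearMap k (fun _ : Fin n => DeRham k (Fin d) A) (DeRham k (Fin d) A) :=
  DeRham.multilift (X.form n)

theorem bracket_cls {n : ℕ} (a : Fin n → A) :
    X.bracket n (fun i => cls k (Fin d) (a i)) = X.form n a :=
  DeRham.multilift_cls _ (X.form_update_del n) a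

theorem bracket_one (x : Fin 1 → DeRham k (Fin d) A) : X.bracket 1 x = dDeRham k d A (x 0) := by
  obtain ⟨a, ha⟩ := clsHom_surjective (x 0)
  have : x = fun _ => cls k (Fin d) a := funext fun i => by
    rw [Subsingleton.elim i 0, ← ha, clsHom_apply]
  rw [this, bracket_cls, form_one, dDeRham_cls]

/-- The term of `S` in the `L_∞` relations, on the classes of `m_1, …, m_n`. -/
def jacobiTerm {n : ℕ} (deg : Fin n → ℤ) (m : Fin n → A) (S : Finset (Fin n)) :
    DeRham k (Fin d) A :=
  jacobiSign S deg • X.bracket (Sᶜ.card + 1)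
    (Fin.cons (X.bracket S.card ((fun i => cls k (Fin d) (m i)) ∘ enum S))
      ((fun i => cls k (Fin d) (m i)) ∘ enum Sᶜ))

theorem cons_cls {n : ℕ} (b : A) (m : Fin n → A) :
    (Fin.cons (cls k (Fin d) b) fun i => cls k (Fin d) (m i) : Fin (n + 1) → DeRham k (Fin d) A) =
      fun i => cls k (Fin d) ((Fin.cons b m : Fin (n + 1) → A) i) := by
  funext i
  cases i using Fin.cases <;> rfl

theorem jacobiTerm_univ {n : ℕ} (deg : Fin n → ℤ) (m : Fin n → A) :
    X.jacobiTerm deg m Finset.univ = dDeRham k d A (X.form n m) := by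
  have h : X.bracket (Finset.univ : Finset (Fin n)).card
      ((fun i => cls k (Fin d) (m i)) ∘ enum Finset.univ) = X.form n m := by
    rw [← bracket_cls]
    refine multilinear_cast X.bracket (Finset.card_fin n) _ _ fun i => ?_
    rw [Function.comp_apply, enum_univ]
  rw [jacobiTerm, jacobiSign_univ, one_smul, h, ← X.bracket_one fun _ => X.form n m]
  refine multilinear_cast X.bracket (by simp) _ _ fun i => ?_
  obtain rfl : i = 0 := Fin.ext (by have := i.2; simp at this; simpa using this)
  rfl

/-- The terms of the singletons are those of the differential of `A^{⊠ n}`: antisymmetry moves the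
argument `d m_i` from the first position back to the `i`-th. -/
theorem jacobiTerm_singleton {n : ℕ} (deg : Fin n → ℤ) (m : Fin n → A)
    (hm : ∀ i, m i ∈ grade k d A (deg i)) (i : Fin n) :
    X.jacobiTerm deg m {i} = ((n : ℤ) - 1).negOnePow • (∑ j with j < i, deg j).negOnePow •
      X.form n (Function.update m i (dA k d A (m i))) := by
  obtain ⟨p, rfl⟩ : ∃ p, n = p + 1 := ⟨n - 1, by have := i.2; omega⟩
  set m' := Function.update m i (dA k d A (m i)) with hm'
  have hdeg : ∀ j, m' j ∈ grade k d A (Function.update deg i (deg i + 1) j) := by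
    intro j
    by_cases h : j = i
    · subst h
      simpa [hm'] using dA_mem_grade (hm j)
    · simpa [hm', h] using hm j
  have h1 : X.bracket ({i} : Finset (Fin (p + 1))).card
      ((fun i => cls k (Fin d) (m i)) ∘ enum {i}) = cls k (Fin d) (dA k d A (m i)) := by
    rw [← X.form_one fun _ => m i, ← bracket_cls]
    refine multilinear_cast X.bracket (Finset.card_singleton i) _ _ fun j => ?_
    rw [Function.comp_apply, Finset.mem_singleton.1 (enum_mem _ j)]
  have h2 : X.bracket (({i} : Finset (Fin (p + 1)))ᶜ.card + 1)
      (Fin.cons (cls k (Fin d) (dA k d A (m i))) ((fun i => cls k (Fin d) (m i)) ∘ enum {i}ᶜ)) =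
        X.form (p + 1) (m' ∘ i.cycleRange.symm) := by
    rw [← bracket_cls]
    refine multilinear_cast X.bracket (by rw [card_compl_singleton_fin]) _ _ fun j => ?_
    cases j using Fin.cases with
    | zero =>
      rw [Fin.cons_zero, Fin.cast_zero, Function.comp_apply, Fin.cycleRange_symm_zero, hm',
        Function.update_self]
    | succ j =>
      rw [Fin.cons_succ, Function.comp_apply, Function.comp_apply, enum_compl_singleton,
        ← Fin.succ_cast_eq, Fin.cycleRange_symm_succ, hm',
        Function.update_of_ne (Fin.succAbove_ne _ _)]
  have h3 : X.form (p + 1) (m' ∘ i.cycleRange.symm) =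
      (koszul i.cycleRange (Function.update deg i (deg i + 1)) *
        Equiv.Perm.sign i.cycleRange) • X.form (p + 1) m' := by
    rw [mul_smul, ← X.form_skew (p + 1) _ m' hdeg i.cycleRange, ← mul_smul, Int.units_mul_self,
      one_smul]
  rw [jacobiTerm, h1, h2, h3, ← mul_smul, jacobiSign_singleton, mul_smul]

theorem jacobiTerm_of_two_le {n : ℕ} (deg : Fin n → ℤ) (m : Fin n → A) (S : Finset (Fin n))
    (h : 2 ≤ S.card) (h' : S.card < n) (e : ℤ) :
    X.jacobiTerm deg m S = jacobiSign S deg • Delta.toDeRham k d n A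
      (ChiralOp.comp S (X.op (Sᶜ.card + 1)) (X.op S.card) e m 1) := by
  have hc : 2 ≤ Sᶜ.card + 1 := by
    rw [Finset.card_compl, Fintype.card_fin]
    omega
  obtain ⟨b, hb⟩ := clsHom_surjective (X.form S.card fun i => m (enum S i))
  rw [jacobiTerm, ChiralOp.toDeRham_comp S _ _ e m b
    (by rw [← X.form_of_two_le h, ← hb, clsHom_apply]), ← X.form_of_two_le hc, ← bracket_cls,
    ← cons_cls]
  congr 3
  exact (X.bracket_cls fun i => m (enum S i)).trans hb.symm

theorem sum_jacobiTerm (n : ℕ) (deg : Fin n → ℤ) (m : Fin n → A)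
    (hm : ∀ i, m i ∈ grade k d A (deg i)) :
    ∑ S : Finset (Fin n) with S.Nonempty, X.jacobiTerm deg m S = 0 := by
  match n with
  | 0 =>
    refine Finset.sum_eq_zero fun S hS => ?_
    obtain ⟨i, -⟩ := (Finset.mem_filter.1 hS).2
    exact i.elim0
  | 1 =>
    refine Finset.sum_eq_zero fun S hS => ?_
    obtain rfl : S = Finset.univ := (Finset.mem_filter.1 hS).2.eq_univ
    rw [jacobiTerm_univ, form_one, dDeRham_cls]
    exact (congrArg _ (DGRightDModule.diff_diff (m 0))).trans (map_zero (clsHom k (Fin d) A))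
  | p + 2 =>
    have hn : 2 ≤ p + 2 := by omega
    have h := congrArg (Delta.toDeRham k d (p + 2) A) (X.op_relation (p + 2) hn deg m hm 1)
    have hd : Jou.diff (1 : JConf k d (p + 2)) = 0 := by simp [Jou.diff]
    rw [hd] at h
    simp only [map_add, map_sum, map_zero, smul_zero, add_zero, Units.smul_def, map_zsmul,
      toDeRham_diff] at h
    rw [sum_nonempty_eq hn, jacobiTerm_univ, X.form_of_two_le hn]
    refine Eq.trans (congrArg₂ _ (congrArg₂ _ rfl ?_) ?_) h
    · rw [Finset.smul_sum]
      exact Finset.sum_congr rfl fun i _ => X.jacobiTerm_singleton deg m hm i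
    · refine Finset.sum_congr rfl fun S hS => ?_
      obtain ⟨-, h1, h2⟩ := Finset.mem_filter.1 hS
      exact X.jacobiTerm_of_two_le deg m S h1 h2 _

/-- Homogeneous elements of `h(A)` have homogeneous representatives of the same degree. -/
theorem exists_homogeneous_lift {n : ℕ} {deg : Fin n → ℤ} {x : Fin n → DeRham k (Fin d) A}
    (hx : ∀ i, x i ∈ DeRham.gr k d A (deg i)) :
    ∃ m : Fin n → A, (∀ i, m i ∈ grade k d A (deg i)) ∧ x = fun i => cls k (Fin d) (m i) := by
  choose m hm hx using fun i => DeRham.mem_gr_iff.1 (hx i)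
  exact ⟨m, hm, funext fun i => (hx i).symm⟩

/-- The `L_∞` algebra structure on `h(A)`. -/
def lInfty : LInftyAlgebra k (DeRham k (Fin d) A) (DeRham.gr k d A) where
  gr_internal := DeRham.gr_internal
  bracket := X.bracket
  bracket_zero := rfl
  bracket_degree n deg x hx := by
    obtain ⟨m, hm, rfl⟩ := exists_homogeneous_lift hx
    rw [bracket_cls]
    exact X.form_degree n deg m hm
  bracket_skew n deg x hx σ := by
    obtain ⟨m, hm, rfl⟩ := exists_homogeneous_lift hx
    rw [bracket_cls, ← X.form_skew n deg m hm σ, ← bracket_cls]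
    rfl
  jacobi n deg x hx := by
    obtain ⟨m, hm, rfl⟩ := exists_homogeneous_lift hx
    exact X.sum_jacobiTerm n deg m hm

end HomotopyChiralAlgebra

theorem LInftyAlgebra.ext_bracket {k : Type u} [Field k] {L : Type v} [AddCommGroup L] [Module k L]
    {gr : ℤ → Submodule k L} {P Q : LInftyAlgebra k L gr} (h : ∀ n, P.bracket n = Q.bracket n) :
    P = Q := by
  cases P
  cases Q
  obtain rfl := funext h
  rfl

end HigherChiral

end

theorem mainTheorem10 {k : Type*} [Field k] [CharZero k] (d : ℕ)
    (A : Type*) [AddCommGroup A] [Module k A] [DGRightDModule k d A]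
    (X : HomotopyChiralAlgebra k d A) :
    ∃! L : LInftyAlgebra k (DeRham k (Fin d) A) (DeRham.gr k d A),
      (∀ a : A, L.bracket 1 (fun _ => cls k (Fin d) a) = cls k (Fin d) (dA k d A a)) ∧
      ∀ n : ℕ, 2 ≤ n → ∀ (a : Fin n → A) (b : A),
        L.bracket n (fun i => cls k (Fin d) (a i)) = cls k (Fin d) b ↔
          cls k (Fin n × Fin d) ((X.op n).app a 1) =
            cls k (Fin n × Fin d) (Delta.mk b 1 : Delta k d n A) := by
  have hX : ∀ n : ℕ, 2 ≤ n → ∀ (a : Fin n → A) (b : A),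
      X.form n a = cls k (Fin d) b ↔ cls k (Fin n × Fin d) ((X.op n).app a 1) =
        cls k (Fin n × Fin d) (Delta.mk b 1 : Delta k d n A) := by
    intro n hn a b
    rw [Delta.cls_eq_iff, Delta.toDeRham_mk, map_one MvPolynomial.constantCoeff, one_smul,
      X.form_of_two_le hn, ChiralOp.form_apply]
  refine ⟨X.lInfty, ⟨fun a => X.bracket_cls fun _ => a, fun n hn a b => ?_⟩, ?_⟩
  · rw [← hX n hn]
    exact Eq.congr_left (X.bracket_cls a)
  · rintro L ⟨h1, h2⟩
    refine LInftyAlgebra.ext_bracket fun n => MultilinearMap.ext fun x => ?_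
    choose a ha using fun i => clsHom_surjective (x i)
    obtain rfl : (fun i => cls k (Fin d) (a i)) = x := funext ha
    refine Eq.trans ?_ (X.bracket_cls a).symm
    match n with
    | 0 => exact congrArg (fun B : MultilinearMap k _ _ => B _) L.bracket_zero
    | 1 =>
      have : (fun i => cls k (Fin d) (a i)) = fun _ => cls k (Fin d) (a 0) :=
        funext fun i => by rw [Subsingleton.elim i 0]
      rw [this, h1, X.form_one]
    | n + 2 =>
      obtain ⟨b, hb⟩ := clsHom_surjective (X.form (n + 2) a)
      have hn : 2 ≤ n + 2 := by omega
      exact ((h2 _ hn a b).2 ((hX _ hn a b).1 hb.symm)).trans hb
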